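/- Let $F$ be a number field with ring of adeles $\mathbb A=\mathbb A_\infty\times\mathbb A_f$ (archimedean and finite adeles), let $G$ be a linear algebraic group over $F$ (a closed subgroup scheme of some $\mathrm{GL}_n$), and let $Z$ be its (scheme-theoretic) center. Let $\mathfrak g$ be the Lie algebra of $G(\mathbb A_\infty)$, let $\mathfrak g_{\mathbb C}$ be its complexification, and let $K_\infty$ be a maximal compact subgroup of $G(\mathbb A_\infty)$. Let $R$ denote right translation of functions on $G(\mathbb A)$, and for $X\in\mathfrak g$ put $(R(X)\Phi)(g)=\frac{d}{dt}\big|_{0}\Phi(g\exp(tX))$; this action extends to the universal enveloping algebra $\mathcal U(\mathfrak g_{\mathbb C})$. A function $\Phi:G(\mathbb A)\to\mathbb C$ is called an automorphic form if: (1) $\Phi$ is right invariant under some open compact subgroup of $G(\mathbb A_f)$, and for every $h\in G(\mathbb A)$ the function $g\mapsto\Phi(gh)$ is $C^\infty$ on $G(\mathbb A_\infty)$; (2) the right translates of $\Phi$ by $K_\infty$ span a finite-dimensional space; (3) $\Phi(\gamma g)=\Phi(g)$ for $\gamma\in G(F)$; (4) there is a (continuous) unitary character $\chi$ of $Z(\mathbb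 A)$ with $\Phi(zg)=\chi(z)\Phi(g)$ for $z\in Z(\mathbb A)$. It is called square-integrable if $\int_{G(F)Z(\mathbb A)\backslash G(\mathbb A)}|\Phi(g)|^2\,dg<\infty$, where $dg$ is a nonzero Radon measure on the quotient that is invariant under right translation by $G(\mathbb A)$. An automorphic representation is a complex vector space of automorphic forms that is stable under right translation by $G(\mathbb A_f)$ and $K_\infty$ and under the action of $\mathfrak g$; it is irreducible if it is nonzero and contains no automorphic representations except $0$ and itself. The automorphic representation generated by $\Phi$ is the linear span of all functions obtained from $\Phi$ by (repeatedly) applying the right actions of $G(\mathbb A_f)$, $\mathfrak g$ and $K_\infty$. **Theorem.** For each finite place $v$ of $F$ let $K_v$ be an open compact subgroup of $G(F_v)$; assume that almost all $K_v$ are maximal compact subgroups of $G(F_v)$. Let $\Phi$ be a square-integrable automorphic form on $G(\mathbb A)$ such that: (i) the $(\mathfrak g,K_\infty)$-module spanned by the functions $R(X)R(k)\Phi$, where $X\in\mathcal U(\mathfrak g_{\mathbb C})$ and $k\in K_\infty$, is irreducible; (ii) for each finite place $v$, $\Phi$ is right invariant under $K_v$ and is an eigenvector of the local Hecke algebra $\mathcal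 H(G(F_v),K_v)$ of locally constant, compactly supported, left and right $K_v$-invariant functions $f:G(F_v)\to\mathbb C$, which acts by $R(f)\Phi=\int_{G(F_v)}f(g)R(g)\Phi\,dg$ for a left Haar measure $dg$ on $G(F_v)$. Then the linear span of all functions obtained from $\Phi$ by the right actions of $G(\mathbb A_f)$, $\mathfrak g$ and $K_\infty$ is an irreducible automorphic representation of $G(\mathbb A)$. -/

import Mathlib

open scoped ContDiff
open NumberField IsDedekindDomain MeasureTheory

universe u

/-- The ring `𝔸_∞ = ∏_{v ∣ ∞} F_v` of archimedean adeles, as the product of one copy of `ℝ` for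
each real place and one copy of `ℂ` for each complex place. -/
abbrev ArchAdele (F : Type u) [Field F] : Type u := mixedEmbedding.mixedSpace F

noncomputable instance (F : Type u) [Field F] : Algebra F (ArchAdele F) :=
  (mixedEmbedding F).toAlgebra

/-- The ring `𝔸_f` of finite adeles (the restricted product of the `F_v`, `v` finite). -/
abbrev FinAdele (F : Type u) [Field F] [NumberField F] : Type u := FiniteAdeleRing (𝓞 F) F

/-- The finite places of `F`. -/
abbrev FinPlace (F : Type u) [Field F] : Type u := HeightOneSpectrum (𝓞 F)

/-- The completion `F_v` at a finite place `v`. -/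
abbrev LocalField (F : Type u) [Field F] [NumberField F] (v : FinPlace F) : Type u :=
  v.adicCompletion F

/-- The projection `𝔸_f → F_v`. -/
noncomputable def finComponent (F : Type u) [Field F] [NumberField F] (v : FinPlace F) :
    FinAdele F →ₐ[F] LocalField F v where
  toFun a := a v
  map_one' := rfl
  map_mul' _ _ := rfl
  map_zero' := rfl
  map_add' _ _ := rfl
  commutes' _ := rfl

open Classical in
/-- The inclusion `F_v → 𝔸_f` as the `v`-component (all other components are `0`). -/
noncomputable def finSingle (F : Type u) [Field F] [NumberField F] (v : FinPlace F)
    (x : LocalField F v) : FinAdele F :=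
  ⟨Pi.single v x, by
    refine Set.Finite.subset (Set.finite_singleton v) fun w hw => ?_
    by_contra hne
    apply hw
    have h : Pi.single (M := fun w : FinPlace F => LocalField F w) v x w = 0 :=
      Pi.single_eq_of_ne hne x
    change Pi.single (M := fun w : FinPlace F => LocalField F w) v x w ∈
      w.adicCompletionIntegers F
    rw [h]
    exact zero_mem _⟩

theorem finComponent_finSingle_same (F : Type u) [Field F] [NumberField F] (v : FinPlace F)
    (x : LocalField F v) : finComponent F v (finSingle F v x) = x := by
  classical
  exact Pi.single_eq_same (M := fun w : FinPlace F => LocalField F w) v x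

theorem finComponent_finSingle_ne (F : Type u) [Field F] [NumberField F] {v w : FinPlace F}
    (h : w ≠ v) (x : LocalField F v) : finComponent F w (finSingle F v x) = 0 := by
  classical
  exact Pi.single_eq_of_ne (M := fun w : FinPlace F => LocalField F w) h x

/-- The matrix `M` over the `F`-algebra `R` satisfies all the polynomial equations in `eqs`. -/
def SatisfiesEqs {F : Type u} [Field F] {n : ℕ} (eqs : Set (MvPolynomial (Fin n × Fin n) F))
    {R : Type u} [CommRing R] [Algebra F R] (M : Matrix (Fin n) (Fin n) R) : Prop :=
  ∀ p ∈ eqs, MvPolynomial.aeval (fun ij : Fin n × Fin n => M ij.1 ij.2) p = 0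

theorem SatisfiesEqs.map {F : Type u} [Field F] {n : ℕ}
    {eqs : Set (MvPolynomial (Fin n × Fin n) F)} {R S : Type u} [CommRing R] [Algebra F R]
    [CommRing S] [Algebra F S] (φ : R →ₐ[F] S) {M : Matrix (Fin n) (Fin n) R}
    (hM : SatisfiesEqs eqs M) : SatisfiesEqs eqs (φ.mapMatrix M) := by
  intro p hp
  have h := congrArg φ (hM p hp)
  rw [map_zero, MvPolynomial.comp_aeval_apply] at h
  exact h

/-- A linear algebraic group over `F`: a closed subgroup scheme of `GL_n`, given by polynomial
equations over `F` in the matrix entries whose solutions in `GL_n(R)` form a subgroup for every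
commutative `F`-algebra `R`. -/
structure LinAlgGroup (F : Type u) [Field F] (n : ℕ) where
  /-- The defining equations. -/
  eqs : Set (MvPolynomial (Fin n × Fin n) F)
  one_mem : ∀ (R : Type u) [CommRing R] [Algebra F R],
    SatisfiesEqs eqs (1 : GL (Fin n) R).val
  mul_mem : ∀ (R : Type u) [CommRing R] [Algebra F R] (g h : GL (Fin n) R),
    SatisfiesEqs eqs g.val → SatisfiesEqs eqs h.val → SatisfiesEqs eqs (g * h).val
  inv_mem : ∀ (R : Type u) [CommRing R] [Algebra F R] (g : GL (Fin n) R),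
    SatisfiesEqs eqs g.val → SatisfiesEqs eqs (g⁻¹).val

namespace LinAlgGroup

section Points

variable {F : Type u} [Field F] {n : ℕ} (G : LinAlgGroup F n)

/-- The group `G(R)` of `R`-valued points, as a subgroup of `GL_n(R)`. When `R` is a topological
ring, `GL_n(R)` carries the topology of the unit group of `M_n(R)`, and `G(R)` the subspace
topology. -/
def points (R : Type u) [CommRing R] [Algebra F R] : Subgroup (GL (Fin n) R) where
  carrier := {g | SatisfiesEqs G.eqs g.val}
  one_mem' := G.one_mem R
  mul_mem' {g h} hg hh := G.mul_mem R g h hg hh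
  inv_mem' {g} hg := G.inv_mem R g hg

/-- Functoriality of `R ↦ G(R)`. -/
def mapPoints {R S : Type u} [CommRing R] [Algebra F R] [CommRing S] [Algebra F S]
    (φ : R →ₐ[F] S) : G.points R →* G.points S :=
  ((Matrix.GeneralLinearGroup.map (n := Fin n) φ.toRingHom).comp (G.points R).subtype).codRestrict
    (G.points S) (fun g => SatisfiesEqs.map φ g.2)

/-- The `R`-points `Z(R)` of the centre `Z` of the algebraic group `G`: the points that
commute with all of `G(S)`, for every commutative `R`-algebra `S`. -/
def center (R : Type u) [CommRing R] [Algebra F R] : Subgroup (G.points R) where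
  carrier := {z | ∀ (S : Type u) [CommRing S] [Algebra F S] (φ : R →ₐ[F] S) (g : G.points S),
    G.mapPoints φ z * g = g * G.mapPoints φ z}
  one_mem' := by intro S _ _ φ g; simp
  mul_mem' {a b} ha hb := by
    intro S _ _ φ g
    rw [map_mul, mul_assoc, hb S φ g, ← mul_assoc, ha S φ g, mul_assoc]
  inv_mem' {a} ha := by
    intro S _ _ φ g
    rw [map_inv, inv_mul_eq_iff_eq_mul, ← mul_assoc, ha S φ g, mul_assoc, mul_inv_cancel, mul_one]

end Points

variable {F : Type u} [Field F] [NumberField F] {n : ℕ} (G : LinAlgGroup F n)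

/-- The archimedean group `G(𝔸_∞)`. -/
abbrev ArchGroup : Type u := G.points (ArchAdele F)

/-- The group `G(𝔸_f)`. -/
abbrev FinGroup : Type u := G.points (FinAdele F)

/-- The local group `G(F_v)` at a finite place. -/
abbrev LocalGroup (v : FinPlace F) : Type u := G.points (LocalField F v)

/-- The adelic group `G(𝔸) = G(𝔸_∞) × G(𝔸_f)`. -/
abbrev Adelic : Type u := G.ArchGroup × G.FinGroup

/-- The diagonal embedding `G(F) → G(𝔸)`. -/
noncomputable def diagonal : G.points F →* G.Adelic :=
  (G.mapPoints (Algebra.ofId F (ArchAdele F))).prod (G.mapPoints (Algebra.ofId F (FinAdele F)))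

/-- The group `Z(𝔸) = Z(𝔸_∞) × Z(𝔸_f)`. -/
noncomputable def adelicCenter : Subgroup G.Adelic :=
  (G.center (ArchAdele F)).prod (G.center (FinAdele F))

/-- The matrix over `𝔸_f` with component `g` at `v` and the identity matrix elsewhere. -/
noncomputable def localMatrix (v : FinPlace F) (g : Matrix (Fin n) (Fin n)
    (LocalField F v)) : Matrix (Fin n) (Fin n) (FinAdele F) :=
  1 + (g - 1).map (finSingle F v)

theorem localMatrix_same (v : FinPlace F) (g : Matrix (Fin n) (Fin n)
    (LocalField F v)) : (finComponent F v).mapMatrix (localMatrix v g) = g := by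
  refine Matrix.ext fun i j => ?_
  simp only [localMatrix, map_add, map_one, Matrix.add_apply, AlgHom.mapMatrix_apply,
    Matrix.map_apply, finComponent_finSingle_same, Matrix.sub_apply]
  ring

theorem localMatrix_ne {v w : FinPlace F} (h : w ≠ v) (g : Matrix (Fin n) (Fin n)
    (LocalField F v)) : (finComponent F w).mapMatrix (localMatrix v g) = 1 := by
  refine Matrix.ext fun i j => ?_
  simp only [localMatrix, map_add, map_one, Matrix.add_apply, AlgHom.mapMatrix_apply,
    Matrix.map_apply, finComponent_finSingle_ne F h]
  ring

theorem finMatrix_ext {M N : Matrix (Fin n) (Fin n) (FinAdele F)}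
    (h : ∀ w, (finComponent F w).mapMatrix M = (finComponent F w).mapMatrix N) : M = N := by
  refine Matrix.ext fun i j => ?_
  have := FiniteAdeleRing.ext F (a₁ := M i j) (a₂ := N i j)
    fun w => congrFun (congrFun (h w) i) j
  rw [this]

theorem localMatrix_mul (v : FinPlace F) (g h : Matrix (Fin n) (Fin n)
    (LocalField F v)) : localMatrix v (g * h) = localMatrix v g * localMatrix v h := by
  refine finMatrix_ext fun w => ?_
  rw [map_mul]
  by_cases hw : w = v
  · subst hw
    simp only [localMatrix_same]
  · simp only [localMatrix_ne hw, mul_one]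

theorem localMatrix_one (v : FinPlace F) :
    localMatrix v (1 : Matrix (Fin n) (Fin n) (LocalField F v)) = 1 := by
  refine finMatrix_ext fun w => ?_
  rw [map_one]
  by_cases hw : w = v
  · subst hw
    simp only [localMatrix_same]
  · simp only [localMatrix_ne hw]

/-- The embedding `G(F_v) → G(𝔸_f)` as the `v`-component (all other components are `1`). -/
noncomputable def localEmb (v : FinPlace F) : G.LocalGroup v →* G.FinGroup :=
  ((Units.map (⟨⟨localMatrix v, localMatrix_one v⟩, localMatrix_mul v⟩ :
      Matrix (Fin n) (Fin n) (LocalField F v) →*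
        Matrix (Fin n) (Fin n) (FinAdele F))).comp
    (G.points (LocalField F v)).subtype).codRestrict (G.points (FinAdele F)) (by
      intro g p hp
      refine FiniteAdeleRing.ext F fun w => ?_
      change finComponent F w (MvPolynomial.aeval (fun ij : Fin n × Fin n =>
        localMatrix v g.1.val ij.1 ij.2) p) = 0
      rw [MvPolynomial.comp_aeval_apply]
      by_cases hw : w = v
      · subst hw
        have h := g.2 p hp
        rw [← localMatrix_same w g.1.val] at h
        exact h
      · have h := G.one_mem (LocalField F w) p hp
        rw [Units.val_one, ← localMatrix_ne hw g.1.val] at h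
        exact h)

/-! ### The archimedean group as a Lie group -/

/-- The exponential of a matrix over `𝔸_∞`, as an invertible matrix. -/
noncomputable def glExp (X : Matrix (Fin n) (Fin n) (ArchAdele F)) :
    GL (Fin n) (ArchAdele F) :=
  IsUnit.unit (a := NormedSpace.exp X) (by classical exact Matrix.isUnit_exp X)

/-- The (underlying set of the) Lie algebra `𝔤` of the closed subgroup `G(𝔸_∞)` of
`GL_n(𝔸_∞)`: the matrices `X` with `exp(tX) ∈ G(𝔸_∞)` for all real `t`. -/
noncomputable def lieAlgebra : Set (Matrix (Fin n) (Fin n) (ArchAdele F)) :=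
  {X | ∀ t : ℝ, glExp (t • X) ∈ G.points (ArchAdele F)}

/-- The one-parameter subgroup `t ↦ exp(tX)` of `G(𝔸_∞)`, for `X ∈ 𝔤`. -/
noncomputable def oneParam (X : G.lieAlgebra) (t : ℝ) : G.ArchGroup :=
  ⟨glExp (t • (X : Matrix (Fin n) (Fin n) (ArchAdele F))), X.2 t⟩

open Classical in
/-- `f` is `C^∞` on `G(𝔸_∞)`: near every point it is the restriction of a `C^∞` function (in the
real sense) on an open set of the real vector space of matrices over `𝔸_∞`. -/
def IsSmooth (f : G.ArchGroup → ℂ) : Prop :=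
  ∀ g : G.ArchGroup, ∃ (U : Set (Fin n → Fin n → ArchAdele F))
    (φ : (Fin n → Fin n → ArchAdele F) → ℂ),
    IsOpen U ∧ (fun i j => g.1 i j) ∈ U ∧ ContDiffOn ℝ ∞ φ U ∧
      ∀ h : G.ArchGroup, (fun i j => h.1 i j) ∈ U → f h = φ (fun i j => h.1 i j)

/-! ### Functions on the adelic group -/

/-- Right translation: `(R(y)Φ)(x) = Φ(xy)`. -/
noncomputable def rightTranslate (y : G.Adelic) (Φ : G.Adelic → ℂ) : G.Adelic → ℂ := fun x => Φ (x * y)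

/-- The action of `X ∈ 𝔤`: `(R(X)Φ)(x) = d/dt|₀ Φ(x exp(tX))`. -/
noncomputable def lieDeriv (X : G.lieAlgebra) (Φ : G.Adelic → ℂ) : G.Adelic → ℂ :=
  fun x => deriv (fun t : ℝ => Φ (x * (G.oneParam X t, 1))) 0

/-- A subgroup is maximal compact if it is maximal among the compact subgroups. -/
def _root_.IsMaximalCompact {H : Type*} [Group H] [TopologicalSpace H] (K : Subgroup H) : Prop :=
  Maximal (fun L : Subgroup H => IsCompact (L : Set H)) K

/-- Automorphic forms on `G(𝔸)`, with respect to `K_∞`. -/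
structure IsAutomorphicForm (Kinf : Subgroup G.ArchGroup) (Φ : G.Adelic → ℂ) : Prop where
  /-- Right invariance under some open compact subgroup of `G(𝔸_f)`. -/
  finite_smooth : ∃ Kf : Subgroup G.FinGroup, IsOpen (Kf : Set G.FinGroup) ∧ IsCompact (Kf : Set G.FinGroup) ∧
    ∀ k ∈ Kf, ∀ x, Φ (x * (1, k)) = Φ x
  /-- Smoothness in the archimedean variable. -/
  arch_smooth : ∀ h : G.Adelic, G.IsSmooth fun g => Φ ((g, 1) * h)
  /-- `K_∞`-finiteness. -/
  finite : FiniteDimensional ℂ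
    (Submodule.span ℂ {f | ∃ k ∈ Kinf, f = G.rightTranslate (k, 1) Φ})
  /-- Left invariance under `G(F)`. -/
  left_invariant : ∀ (γ : G.points F) (x : G.Adelic), Φ (G.diagonal γ * x) = Φ x
  /-- The unitary central character. -/
  central_char : ∃ χ : G.adelicCenter →ₜ* Circle,
    ∀ (z : G.adelicCenter) (x : G.Adelic), Φ (z * x) = χ z * Φ x

/-- A subspace of functions is a `(𝔤, K_∞)`-submodule if it is stable under `𝔤` and `K_∞`. -/
structure IsGKInvariant (Kinf : Subgroup G.ArchGroup) (W : Submodule ℂ (G.Adelic → ℂ)) : Prop where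
  lie_mem : ∀ (X : G.lieAlgebra), ∀ f ∈ W, G.lieDeriv X f ∈ W
  compact_mem : ∀ k ∈ Kinf, ∀ f ∈ W, G.rightTranslate (k, 1) f ∈ W

/-- An automorphic representation: a space of automorphic forms stable under right translation
by `G(𝔸_f)` and `K_∞`, and under `𝔤`. -/
structure IsAutomorphicRep (Kinf : Subgroup G.ArchGroup) (W : Submodule ℂ (G.Adelic → ℂ)) : Prop where
  isAutomorphicForm : ∀ f ∈ W, G.IsAutomorphicForm Kinf f
  gk_invariant : G.IsGKInvariant Kinf W
  finite_mem : ∀ (h : G.FinGroup), ∀ f ∈ W, G.rightTranslate (1, h) f ∈ W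

/-- The `(𝔤, K_∞)`-module generated by `Φ`: the span of all `R(X₁)⋯R(X_m)R(k)Φ` with
`X_i ∈ 𝔤`, `k ∈ K_∞`, that is, of all `R(X)R(k)Φ` with `X ∈ U(𝔤_ℂ)`, `k ∈ K_∞`. -/
noncomputable def gkModule (Kinf : Subgroup G.ArchGroup) (Φ : G.Adelic → ℂ) :
    Submodule ℂ (G.Adelic → ℂ) :=
  Submodule.span ℂ {f | ∃ (l : List G.lieAlgebra), ∃ k ∈ Kinf,
    f = l.foldr G.lieDeriv (G.rightTranslate (k, 1) Φ)}

/-- The functions obtained from `Φ` by repeatedly applying the right actions of `G(𝔸_f)`,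
`𝔤` and `K_∞`. -/
inductive Reachable (Kinf : Subgroup G.ArchGroup) (Φ : G.Adelic → ℂ) : (G.Adelic → ℂ) → Prop
  | base : Reachable Kinf Φ Φ
  | finite (h : G.FinGroup) (f : G.Adelic → ℂ) :
      Reachable Kinf Φ f → Reachable Kinf Φ (G.rightTranslate (1, h) f)
  | lie (X : G.lieAlgebra) (f : G.Adelic → ℂ) :
      Reachable Kinf Φ f → Reachable Kinf Φ (G.lieDeriv X f)
  | compact (k : G.ArchGroup) (hk : k ∈ Kinf) (f : G.Adelic → ℂ) :
      Reachable Kinf Φ f → Reachable Kinf Φ (G.rightTranslate (k, 1) f)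

/-- The automorphic representation generated by `Φ`. -/
noncomputable def generatedRep (Kinf : Subgroup G.ArchGroup) (Φ : G.Adelic → ℂ) :
    Submodule ℂ (G.Adelic → ℂ) :=
  Submodule.span ℂ {f | G.Reachable Kinf Φ f}

/-- Irreducibility of a `(𝔤, K_∞)`-module of functions on `G(𝔸)`. -/
structure IsIrreducibleGK (Kinf : Subgroup G.ArchGroup) (M : Submodule ℂ (G.Adelic → ℂ)) : Prop where
  ne_bot : M ≠ ⊥
  eq_bot_or_eq : ∀ W ≤ M, G.IsGKInvariant Kinf W → W = ⊥ ∨ W = M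

/-- Irreducible automorphic representations. -/
structure IsIrreducibleRep (Kinf : Subgroup G.ArchGroup) (V : Submodule ℂ (G.Adelic → ℂ)) : Prop where
  isAutomorphicRep : G.IsAutomorphicRep Kinf V
  ne_bot : V ≠ ⊥
  eq_bot_or_eq : ∀ W ≤ V, G.IsAutomorphicRep Kinf W → W = ⊥ ∨ W = V

/-! ### Square-integrability -/

/-- The subgroup `G(F)Z(𝔸)` of `G(𝔸)`. -/
noncomputable def rationalCenter : Subgroup G.Adelic := G.diagonal.range ⊔ G.adelicCenter

/-- The quotient `G(F)Z(𝔸) \ G(𝔸)`, with the quotient topology. -/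
abbrev AutQuotient : Type u := Quotient (QuotientGroup.rightRel G.rationalCenter)

/-- Right translation by `y ∈ G(𝔸)` on `G(F)Z(𝔸) \ G(𝔸)`. -/
noncomputable def quotientTranslate (y : G.Adelic) : G.AutQuotient → G.AutQuotient :=
  Quotient.map' (· * y) (by
    intro a b h
    rw [QuotientGroup.rightRel_apply] at h ⊢
    simpa [mul_assoc] using h)

/-- `μ` is the (unique up to a positive factor) measure on `G(F)Z(𝔸) \ G(𝔸)` induced by a Haar
measure: a nonzero Radon measure that is invariant under right translation by `G(𝔸)`. -/
structure IsInvariantMeasure [MeasurableSpace G.AutQuotient] (μ : Measure G.AutQuotient) :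
    Prop where
  regular : μ.Regular
  ne_zero : μ ≠ 0
  map_eq : ∀ y : G.Adelic, μ.map (G.quotientTranslate y) = μ

/-- Square-integrability: `|Φ|²` descends to a function `ψ` on `G(F)Z(𝔸) \ G(𝔸)` with finite
integral. -/
def IsSquareIntegrable [MeasurableSpace G.AutQuotient] (μ : Measure G.AutQuotient)
    (Φ : G.Adelic → ℂ) : Prop :=
  ∃ ψ : G.AutQuotient → ENNReal,
    (∀ x : G.Adelic, ψ (Quotient.mk _ x) = ‖Φ x‖ₑ ^ 2) ∧ ∫⁻ q, ψ q ∂μ < ⊤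

/-! ### Local Hecke algebras -/

/-- The local Hecke algebra `H(G(F_v), K)` as a space of functions: the locally constant,
compactly supported functions that are left and right `K`-invariant. -/
structure IsHeckeFunction {v : FinPlace F} (K : Subgroup (G.LocalGroup v)) (f : G.LocalGroup v → ℂ) :
    Prop where
  locallyConstant : IsLocallyConstant f
  hasCompactSupport : HasCompactSupport f
  left_invariant : ∀ k ∈ K, ∀ g, f (k * g) = f g
  right_invariant : ∀ k ∈ K, ∀ g, f (g * k) = f g

/-- The action of the Hecke algebra: `(R(f)Φ)(x) = ∫_{G(F_v)} f(g) Φ(xg) dg`. -/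
noncomputable def heckeAction {v : FinPlace F} [MeasurableSpace (G.LocalGroup v)]
    (ν : Measure (G.LocalGroup v)) (f : G.LocalGroup v → ℂ) (Φ : G.Adelic → ℂ) : G.Adelic → ℂ :=
  fun x => ∫ g, f g * Φ (x * (1, G.localEmb v g)) ∂ν

/-- `Φ` is an eigenvector of the Hecke algebra `H(G(F_v), K)`. -/
def IsHeckeEigenvector {v : FinPlace F} [MeasurableSpace (G.LocalGroup v)] (ν : Measure (G.LocalGroup v))
    (K : Subgroup (G.LocalGroup v)) (Φ : G.Adelic → ℂ) : Prop :=
  Φ ≠ 0 ∧ ∀ f : G.LocalGroup v → ℂ, G.IsHeckeFunction K f → ∃ c : ℂ, G.heckeAction ν f Φ = c • Φ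

end LinAlgGroup

/-! Let V be the space generated by Φ, let M be the (𝔤, K_∞)-module generated by Φ, and let W ⊆ V be
a nonzero automorphic representation. It suffices to show Φ ∈ W. The argument has an algebraic half
and an analytic half.

Algebra (`exists_mem_ne_zero_mem_span_translates`). The action of G(𝔸_f) commutes with 𝔤 and K_∞, so
V lies in the sum of the translates R(b)M, which are images of the simple module M over the algebra
of operators generated by 𝔤 and K_∞. Hence W is semisimple and receives a nonzero map from M. As Φ
is K_∞-finite, M has countable dimension, so its endomorphisms are scalars by Dixmier's lemma. The
map M → W is therefore a scalar combination of translations, and the image of Φ is a nonzero w ∈ W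
of the form Σ c_i R(h_i)Φ with h_i ∈ G(𝔸_f).

Analysis (`mem_of_mem_span_translates`). Right translation is unitary for the Petersson product.
Since w is a combination of translates of Φ, it is not orthogonal to all of them, and a translate w'
of w satisfies ⟨w', Φ⟩ ≠ 0. As Φ is fixed by an open subgroup, the h_i occurring in w' may be taken
trivial outside a finite set S of places. For v ∈ S, summing translates over representatives of a
finite quotient of K_v realises a Hecke operator up to a scalar, so a suitable finite sum of
translates of w' by elements fixing Φ equals cΦ (`exists_average`). Pairing with Φ multiplies ⟨w',
Φ⟩ by the number of summands, so c ≠ 0 and Φ ∈ W. -/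

namespace LinAlgGroup

variable {F : Type u} [Field F] [NumberField F] {n : ℕ} (G : LinAlgGroup F n)

/-! ### Derivatives along 𝔤 of functions smooth in the archimedean variable -/

section ArchimedeanDerivative

open scoped Classical

/-- The matrix entries of a point of `G(𝔸_∞)`. -/
def archEntries (g : G.ArchGroup) : Fin n → Fin n → ArchAdele F := fun i j => g.1 i j

omit [NumberField F] in
theorem continuous_archEntries : Continuous G.archEntries := by
  have h : Continuous fun g : G.ArchGroup => (g.1.val : Matrix (Fin n) (Fin n) (ArchAdele F)) :=
    Units.continuous_val.comp continuous_subtype_val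
  exact continuous_pi fun i => continuous_pi fun j => h.matrix_elem i j

theorem glExp_val (X : Matrix (Fin n) (Fin n) (ArchAdele F)) :
    (glExp X).val = NormedSpace.exp X := rfl

theorem hasDerivAt_glExp (X : Matrix (Fin n) (Fin n) (ArchAdele F)) (i j : Fin n) :
    HasDerivAt (fun t : ℝ => (glExp (t • X)).val i j) (X i j) 0 := by
  -- The norm is auxiliary: both the exponential and the entrywise conclusion depend only on the
  -- topology of the matrix space.
  let _ : NormedRing (Matrix (Fin n) (Fin n) (ArchAdele F)) := Matrix.linftyOpNormedRing
  let _ : NormedAlgebra ℝ (Matrix (Fin n) (Fin n) (ArchAdele F)) := Matrix.linftyOpNormedAlgebra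
  have h := hasDerivAt_exp_smul_const (𝕂 := ℝ) X 0
  rw [zero_smul, NormedSpace.exp_zero, one_mul] at h
  let L : Matrix (Fin n) (Fin n) (ArchAdele F) →L[ℝ] ArchAdele F :=
    ⟨Matrix.entryLinearMap ℝ _ i j, continuous_id.matrix_elem i j⟩
  exact L.hasFDerivAt.comp_hasDerivAt (0 : ℝ) h

theorem oneParam_zero (X : G.lieAlgebra) : G.oneParam X 0 = 1 := by
  apply Subtype.ext
  apply Units.ext
  change NormedSpace.exp ((0 : ℝ) • (X : Matrix (Fin n) (Fin n) (ArchAdele F))) = 1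
  rw [zero_smul, NormedSpace.exp_zero]

theorem hasDerivAt_archEntries_mul_oneParam (g : G.ArchGroup) (X : G.lieAlgebra) :
    HasDerivAt (fun t : ℝ => G.archEntries (g * G.oneParam X t))
      (fun i j => (g.1.val * X.1) i j) 0 := by
  refine hasDerivAt_pi.2 fun i => hasDerivAt_pi.2 fun j => ?_
  simp only [Matrix.mul_apply]
  exact HasDerivAt.fun_sum (u := Finset.univ) fun k _ => (hasDerivAt_glExp X.1 k j).const_mul (g.1.val i k)

/-- Chain rule along t ↦ g exp(tX), which stays in U for small t. The formula shows that the
derivative is real-linear in the matrix X. -/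
theorem hasDerivAt_mul_oneParam {f : G.ArchGroup → ℂ} {U : Set (Fin n → Fin n → ArchAdele F)}
    {φ : (Fin n → Fin n → ArchAdele F) → ℂ} (hU : IsOpen U) (hφ : ContDiffOn ℝ ∞ φ U)
    (hf : ∀ h, G.archEntries h ∈ U → f h = φ (G.archEntries h)) (g : G.ArchGroup)
    (hg : G.archEntries g ∈ U) (X : G.lieAlgebra) :
    HasDerivAt (fun t : ℝ => f (g * G.oneParam X t))
      (fderiv ℝ φ (G.archEntries g) (fun i j => (g.1.val * X.1) i j)) 0 := by
  have hc := G.hasDerivAt_archEntries_mul_oneParam g X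
  have h0 : G.archEntries (g * G.oneParam X 0) = G.archEntries g := by
    rw [oneParam_zero, mul_one]
  have hd : DifferentiableAt ℝ φ (G.archEntries g) :=
    (hφ.contDiffAt (hU.mem_nhds hg)).differentiableAt (by simp)
  have hφ' : HasFDerivAt φ (fderiv ℝ φ (G.archEntries g)) (G.archEntries (g * G.oneParam X 0)) := by
    rw [h0]; exact hd.hasFDerivAt
  refine (hφ'.comp_hasDerivAt (0 : ℝ) hc).congr_of_eventuallyEq ?_
  have := hc.continuousAt.preimage_mem_nhds (hU.mem_nhds (h0 ▸ hg))
  filter_upwards [this] with t ht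
  exact hf _ ht

theorem isSmooth_iff {f : G.ArchGroup → ℂ} : G.IsSmooth f ↔
    ∀ g, ∃ (U : Set (Fin n → Fin n → ArchAdele F)) (φ : (Fin n → Fin n → ArchAdele F) → ℂ),
      IsOpen U ∧ G.archEntries g ∈ U ∧ ContDiffOn ℝ ∞ φ U ∧
        ∀ h : G.ArchGroup, G.archEntries h ∈ U → f h = φ (G.archEntries h) := Iff.rfl

variable {G} in
theorem IsSmooth.deriv_oneParam {f : G.ArchGroup → ℂ} (hf : G.IsSmooth f) (X : G.lieAlgebra) :
    G.IsSmooth fun g => deriv (fun t : ℝ => f (g * G.oneParam X t)) 0 := by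
  intro g
  obtain ⟨U, φ, hU, hg, hφ, hfφ⟩ := G.isSmooth_iff.1 hf g
  -- The local extension of the derivative is M ↦ dφ_M(MX), smooth on the same open set.
  refine ⟨U, fun M => fderiv ℝ φ M (fun i j => ∑ k, M i k * X.1 k j), hU, hg, ?_, fun h hh =>
    (G.hasDerivAt_mul_oneParam hU hφ hfφ h hh X).deriv⟩
  refine ContDiffOn.clm_apply (hφ.fderiv_of_isOpen hU (by simp)) ?_
  refine ContDiff.contDiffOn ?_
  fun_prop

variable {G} in
theorem IsSmooth.comp_mul_right {f : G.ArchGroup → ℂ} (hf : G.IsSmooth f) (a : G.ArchGroup) :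
    G.IsSmooth fun g => f (g * a) := by
  intro g
  obtain ⟨U, φ, hU, hg, hφ, hfφ⟩ := G.isSmooth_iff.1 hf (g * a)
  let m : (Fin n → Fin n → ArchAdele F) → (Fin n → Fin n → ArchAdele F) :=
    fun M i j => ∑ k, M i k * a.1.val k j
  have hm : ContDiff ℝ ∞ m := by fun_prop
  have hma : ∀ h : G.ArchGroup, m (G.archEntries h) = G.archEntries (h * a) := fun h => rfl
  refine ⟨m ⁻¹' U, φ ∘ m, hU.preimage hm.continuous, ?_, hφ.comp hm.contDiffOn fun _ h => h,
    fun h hh => ?_⟩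
  · exact hg
  · exact hfφ (h * a) hh

variable {G} in
theorem IsSmooth.add {f f' : G.ArchGroup → ℂ} (hf : G.IsSmooth f) (hf' : G.IsSmooth f') :
    G.IsSmooth (f + f') := by
  intro g
  obtain ⟨U, φ, hU, hg, hφ, hfφ⟩ := hf g
  obtain ⟨U', φ', hU', hg', hφ', hfφ'⟩ := hf' g
  exact ⟨U ∩ U', φ + φ', hU.inter hU', ⟨hg, hg'⟩,
    (hφ.mono Set.inter_subset_left).add (hφ'.mono Set.inter_subset_right), fun h hh => by
      rw [Pi.add_apply, Pi.add_apply, hfφ h hh.1, hfφ' h hh.2]⟩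

variable {G} in
theorem IsSmooth.const_smul {f : G.ArchGroup → ℂ} (hf : G.IsSmooth f) (c : ℂ) :
    G.IsSmooth (c • f) := by
  intro g
  obtain ⟨U, φ, hU, hg, hφ, hfφ⟩ := hf g
  exact ⟨U, c • φ, hU, hg, hφ.const_smul c, fun h hh => by
      rw [Pi.smul_apply, Pi.smul_apply, hfφ h hh]⟩

theorem isSmooth_zero : G.IsSmooth 0 := fun _ =>
  ⟨Set.univ, 0, isOpen_univ, Set.mem_univ _, contDiff_const.contDiffOn, fun _ _ => rfl⟩

variable {G} in
theorem IsSmooth.continuous {f : G.ArchGroup → ℂ} (hf : G.IsSmooth f) : Continuous f := by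
  refine continuous_iff_continuousAt.2 fun g => ?_
  obtain ⟨U, φ, hU, hg, hφ, hfφ⟩ := G.isSmooth_iff.1 hf g
  have h1 : ContinuousAt (φ ∘ G.archEntries) g :=
    (hφ.continuousOn.continuousAt (hU.mem_nhds hg)).comp G.continuous_archEntries.continuousAt
  refine h1.congr ?_
  filter_upwards [G.continuous_archEntries.continuousAt.preimage_mem_nhds (hU.mem_nhds hg)] with h hh
  exact (hfφ h hh).symm

/-- The functions on `G(𝔸)` that are smooth in the archimedean variable. -/
def smoothFunctions : Submodule ℂ (G.Adelic → ℂ) where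
  carrier := {f | ∀ h : G.Adelic, G.IsSmooth fun g => f ((g, 1) * h)}
  zero_mem' _ := G.isSmooth_zero
  add_mem' hf hf' h := (hf h).add (hf' h)
  smul_mem' c _ hf h := (hf h).const_smul c

variable {G}

theorem isSmooth_slice {f : G.Adelic → ℂ} (hf : f ∈ G.smoothFunctions) (b : G.FinGroup) :
    G.IsSmooth fun g => f (g, b) := by
  simpa using hf (1, b)

theorem mem_smoothFunctions_iff {f : G.Adelic → ℂ} :
    f ∈ G.smoothFunctions ↔ ∀ b : G.FinGroup, G.IsSmooth fun g => f (g, b) := by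
  refine ⟨isSmooth_slice, fun h x => ?_⟩
  have := (h x.2).comp_mul_right x.1
  convert this using 3
  ext1 <;> simp

theorem rightTranslate_mem_smoothFunctions {f : G.Adelic → ℂ} (hf : f ∈ G.smoothFunctions)
    (y : G.Adelic) : G.rightTranslate y f ∈ G.smoothFunctions := fun h => by
  simpa only [rightTranslate, mul_assoc] using hf (h * y)

theorem lieDeriv_apply (X : G.lieAlgebra) (f : G.Adelic → ℂ) (a : G.ArchGroup) (b : G.FinGroup) :
    G.lieDeriv X f (a, b) = deriv (fun t : ℝ => f (a * G.oneParam X t, b)) 0 := by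
  simp [lieDeriv]

theorem lieDeriv_mem_smoothFunctions {f : G.Adelic → ℂ} (hf : f ∈ G.smoothFunctions)
    (X : G.lieAlgebra) : G.lieDeriv X f ∈ G.smoothFunctions := by
  refine mem_smoothFunctions_iff.2 fun b => ?_
  simpa only [lieDeriv_apply] using (isSmooth_slice hf b).deriv_oneParam X

/-- At every point, the derivative of a smooth function in the direction `X` is the value at `X`
of a real linear functional on matrices. -/
theorem exists_hasDerivAt_linear {f : G.Adelic → ℂ} (hf : f ∈ G.smoothFunctions) (x : G.Adelic) :
    ∃ D : Matrix (Fin n) (Fin n) (ArchAdele F) →ₗ[ℝ] ℂ, ∀ X : G.lieAlgebra,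
      HasDerivAt (fun t : ℝ => f (x * (G.oneParam X t, 1))) (D X.1) 0 := by
  obtain ⟨a, b⟩ := x
  obtain ⟨U, φ, hU, hg, hφ, hfφ⟩ := G.isSmooth_iff.1 (isSmooth_slice hf b) a
  let m : Matrix (Fin n) (Fin n) (ArchAdele F) →ₗ[ℝ] (Fin n → Fin n → ArchAdele F) :=
    LinearMap.mulLeft ℝ a.1.val
  refine ⟨(fderiv ℝ φ (G.archEntries a)).toLinearMap ∘ₗ m, fun X => ?_⟩
  simp only [Prod.mk_mul_mk, mul_one]
  exact G.hasDerivAt_mul_oneParam hU hφ hfφ a hg X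

theorem exists_lieDeriv_eq {f : G.Adelic → ℂ} (hf : f ∈ G.smoothFunctions) (x : G.Adelic) :
    ∃ D : Matrix (Fin n) (Fin n) (ArchAdele F) →ₗ[ℝ] ℂ, ∀ X : G.lieAlgebra,
      G.lieDeriv X f x = D X.1 :=
  (exists_hasDerivAt_linear hf x).imp fun _ h X => (h X).deriv

theorem hasDerivAt_lieDeriv {f : G.Adelic → ℂ} (hf : f ∈ G.smoothFunctions) (x : G.Adelic)
    (X : G.lieAlgebra) :
    HasDerivAt (fun t : ℝ => f (x * (G.oneParam X t, 1))) (G.lieDeriv X f x) 0 := by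
  obtain ⟨D, hD⟩ := exists_hasDerivAt_linear hf x
  exact (hD X).differentiableAt.hasDerivAt

variable (G) in
/-- The action of `X ∈ 𝔤` on smooth functions. -/
noncomputable def lieOperator (X : G.lieAlgebra) : Module.End ℂ G.smoothFunctions where
  toFun f := ⟨G.lieDeriv X f, lieDeriv_mem_smoothFunctions f.2 X⟩
  -- Additivity of `deriv` needs differentiability, which is why the operator is defined on smooth
  -- functions only.
  map_add' f f' := Subtype.ext <| funext fun x =>
    ((hasDerivAt_lieDeriv f.2 x X).add (hasDerivAt_lieDeriv f'.2 x X)).deriv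
  map_smul' c f := Subtype.ext <| funext fun x =>
    ((hasDerivAt_lieDeriv f.2 x X).const_smul c).deriv

variable (G) in
/-- Right translation on smooth functions. -/
noncomputable def translateOperator (y : G.Adelic) : Module.End ℂ G.smoothFunctions where
  toFun f := ⟨G.rightTranslate y f, rightTranslate_mem_smoothFunctions f.2 y⟩
  map_add' _ _ := rfl
  map_smul' _ _ := rfl

theorem oneParam_conj (a : G.ArchGroup) (X : G.lieAlgebra) :
    ∃ Y : G.lieAlgebra, ∀ t : ℝ, G.oneParam Y t = a * G.oneParam X t * a⁻¹ := by
  have key : ∀ t : ℝ, glExp (t • (a.1.val * X.1 * (a.1⁻¹).val)) = a.1 * glExp (t • X.1) * a.1⁻¹ := by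
    intro t
    apply Units.ext
    rw [glExp_val, Units.val_mul, Units.val_mul, glExp_val, ← Matrix.exp_units_conj, mul_smul_comm,
      smul_mul_assoc]
  refine ⟨⟨a.1.val * X.1 * (a.1⁻¹).val, fun t => ?_⟩, fun t => Subtype.ext (key t)⟩
  rw [key]
  exact (G.points _).mul_mem ((G.points _).mul_mem a.2 (X.2 t)) ((G.points _).inv_mem a.2)

/-- This is R(a)R(X) = R(Ad(a)X)R(a), with Y = aXa⁻¹. -/
theorem exists_rightTranslate_lieDeriv (a : G.ArchGroup) (X : G.lieAlgebra) :
    ∃ Y : G.lieAlgebra, ∀ (b : G.FinGroup) (f : G.Adelic → ℂ),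
      G.rightTranslate (a, b) (G.lieDeriv X f) = G.lieDeriv Y (G.rightTranslate (a, b) f) := by
  obtain ⟨Y, hY⟩ := oneParam_conj a X
  refine ⟨Y, fun b f => funext fun x => ?_⟩
  simp only [rightTranslate, lieDeriv, hY]
  congr 1
  funext t
  congr 1
  ext1 <;> simp [mul_assoc]

theorem rightTranslate_fin_lieDeriv (b : G.FinGroup) (X : G.lieAlgebra) (f : G.Adelic → ℂ) :
    G.rightTranslate (1, b) (G.lieDeriv X f) = G.lieDeriv X (G.rightTranslate (1, b) f) := by
  funext x
  simp only [rightTranslate, lieDeriv]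
  congr 1
  funext t
  congr 1
  ext1 <;> simp [mul_assoc]

theorem rightTranslate_rightTranslate (y z : G.Adelic) (f : G.Adelic → ℂ) :
    G.rightTranslate y (G.rightTranslate z f) = G.rightTranslate (y * z) f := by
  funext x
  simp only [rightTranslate, mul_assoc]

theorem rightTranslate_one (f : G.Adelic → ℂ) : G.rightTranslate 1 f = f := by
  funext x
  simp only [rightTranslate, mul_one]

/-- The derivatives of a finite-dimensional space of smooth functions span a finite-dimensional
space. -/
theorem finiteDimensional_span_lieDeriv (N : Submodule ℂ (G.Adelic → ℂ)) [FiniteDimensional ℂ N]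
    (hN : N ≤ G.smoothFunctions) :
    FiniteDimensional ℂ (Submodule.span ℂ {g | ∃ X : G.lieAlgebra, ∃ f ∈ N, g = G.lieDeriv X f}) := by
  -- A basis of the real span of 𝔤 is picked inside 𝔤 itself. Linearity of the derivative in the
  -- matrix then suffices, and closure of 𝔤 under addition is never needed.
  obtain ⟨Y, hY, hspan, -⟩ := Submodule.exists_fun_fin_finrank_span_eq ℝ (lieAlgebra G)
  let N' : Submodule ℂ G.smoothFunctions := N.comap G.smoothFunctions.subtype
  have : FiniteDimensional ℂ N' :=
    (Submodule.comapSubtypeEquivOfLe hN).symm.finiteDimensional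
  refine Submodule.finiteDimensional_of_le (S₂ := ⨆ i, N'.map
    (G.smoothFunctions.subtype ∘ₗ G.lieOperator ⟨Y i, hY i⟩)) (Submodule.span_le.2 ?_)
  rintro _ ⟨X, f, hf, rfl⟩
  have hX : X.1 ∈ Submodule.span ℝ (Set.range Y) := by
    rw [hspan]
    exact Submodule.subset_span X.2
  obtain ⟨c, hc⟩ := (Submodule.mem_span_range_iff_exists_fun ℝ).1 hX
  have key : G.lieDeriv X f = ∑ i, (c i : ℂ) • G.lieDeriv ⟨Y i, hY i⟩ f := by
    funext x
    obtain ⟨D, hD⟩ := exists_lieDeriv_eq (hN hf) x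
    rw [hD, ← hc, map_sum]
    simp [hD]
  rw [key]
  refine Submodule.sum_mem _ fun i _ => Submodule.smul_mem _ _ ?_
  exact Submodule.mem_iSup_of_mem i ⟨⟨f, hN hf⟩, hf, rfl⟩

end ArchimedeanDerivative

end LinAlgGroup

namespace LinAlgGroup

/-! ### Local components of G(𝔸_f) and approximation by finitely supported elements -/

section FiniteComponents

variable {F : Type u} [Field F] [NumberField F] {n : ℕ}

/-- A net of finite adeles whose components are eventually those of `x`, and integral as long as
they are not, converges to `x`. -/
theorem tendsto_finAdele {x : FinAdele F} {y : Finset (FinPlace F) → FinAdele F}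
    (hx : ∀ S, ∀ w ∈ S, y S w = x w) (hy : ∀ S, ∀ w ∉ S, y S w ∈ w.adicCompletionIntegers F) :
    Filter.Tendsto y Filter.atTop (nhds x) := by
  classical
  have hfin : {w : FinPlace F | x w ∉ w.adicCompletionIntegers F}.Finite := x.2
  -- The difference y S - x as a point of the product of the integer rings, whose topology is the
  -- product topology. The default value 0 is harmless: once S contains the places where x is not
  -- integral, d S is the true difference.
  let d : Finset (FinPlace F) → ∀ w : FinPlace F, w.adicCompletionIntegers F := fun S w =>
    if h : w ∉ S ∧ y S w - x w ∈ w.adicCompletionIntegers F then ⟨y S w - x w, h.2⟩ else 0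
  have hd : Filter.Tendsto d Filter.atTop (nhds 0) := by
    refine tendsto_pi_nhds.2 fun w => tendsto_nhds_of_eventually_eq ?_
    filter_upwards [Filter.eventually_ge_atTop {w}] with S hS
    exact dif_neg fun h => h.1 (hS (Finset.mem_singleton_self w))
  let m : (∀ w : FinPlace F, w.adicCompletionIntegers F) → FinAdele F :=
    RestrictedProduct.structureMap (fun w : FinPlace F => w.adicCompletion F)
      (fun w => (w.adicCompletionIntegers F : Set (w.adicCompletion F))) Filter.cofinite
  have hm : Continuous m := RestrictedProduct.isEmbedding_structureMap.continuous
  have hm0 : m 0 = 0 := rfl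
  have h1 : Filter.Tendsto (fun S => x + m (d S)) Filter.atTop (nhds x) := by
    have := (hm.tendsto 0).comp hd
    rw [hm0] at this
    simpa using this.const_add x
  refine h1.congr' ?_
  filter_upwards [Filter.eventually_ge_atTop hfin.toFinset] with S hS
  refine FiniteAdeleRing.ext F fun w => ?_
  change x w + (d S w : w.adicCompletion F) = y S w
  by_cases hw : w ∈ S
  · have : d S w = 0 := dif_neg fun h => h.1 hw
    rw [this, hx S w hw]
    exact add_zero _
  · have hxw : x w ∈ w.adicCompletionIntegers F := by
      by_contra hne
      exact hw (hS (hfin.mem_toFinset.2 hne))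
    have : d S w = ⟨y S w - x w, sub_mem (hy S w hw) hxw⟩ :=
      dif_pos ⟨hw, sub_mem (hy S w hw) hxw⟩
    rw [this]
    exact add_sub_cancel _ _

variable (G : LinAlgGroup F n)

/-- The projection `G(𝔸_f) → G(F_w)`. -/
noncomputable def component (w : FinPlace F) : G.FinGroup →* G.LocalGroup w :=
  G.mapPoints (finComponent F w)

variable {G}

theorem fin_ext {g h : G.FinGroup} (H : ∀ w, G.component w g = G.component w h) : g = h :=
  Subtype.ext <| Units.ext <| finMatrix_ext fun w =>
    congrArg (fun a : G.LocalGroup w => a.1.val) (H w)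

theorem component_localEmb_same (v : FinPlace F) (g : G.LocalGroup v) :
    G.component v (G.localEmb v g) = g :=
  Subtype.ext <| Units.ext <| localMatrix_same v g.1.val

theorem component_localEmb_ne {v w : FinPlace F} (h : w ≠ v) (g : G.LocalGroup v) :
    G.component w (G.localEmb v g) = 1 :=
  Subtype.ext <| Units.ext <| localMatrix_ne h g.1.val

/-- The subgroup of the elements of `G(𝔸_f)` whose components outside `S` are trivial. -/
noncomputable def supportedOn (G : LinAlgGroup F n) (S : Set (FinPlace F)) : Subgroup G.FinGroup :=
  ⨅ w : (Sᶜ : Set (FinPlace F)), (G.component w).ker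

theorem mem_supportedOn {S : Set (FinPlace F)} {g : G.FinGroup} :
    g ∈ G.supportedOn S ↔ ∀ w ∉ S, G.component w g = 1 := by
  simp [supportedOn, Subgroup.mem_iInf, MonoidHom.mem_ker]

theorem supportedOn_mono {S T : Set (FinPlace F)} (h : S ⊆ T) :
    G.supportedOn S ≤ G.supportedOn T := fun _ hg =>
  mem_supportedOn.2 fun w hw => mem_supportedOn.1 hg w fun hS => hw (h hS)

theorem localEmb_mem_supportedOn (v : FinPlace F) (g : G.LocalGroup v) :
    G.localEmb v g ∈ G.supportedOn {v} :=
  mem_supportedOn.2 fun _ hw => component_localEmb_ne hw g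

theorem localEmb_commute {v : FinPlace F} {S : Set (FinPlace F)} (hv : v ∉ S) (g : G.LocalGroup v)
    {h : G.FinGroup} (hh : h ∈ G.supportedOn S) : Commute (G.localEmb v g) h := by
  refine fin_ext fun w => ?_
  rw [map_mul, map_mul]
  by_cases hw : w = v
  · subst hw
    rw [mem_supportedOn.1 hh w hv, mul_one, one_mul]
  · rw [component_localEmb_ne hw, mul_one, one_mul]

theorem exists_eq_localEmb_mul {v : FinPlace F} {S : Set (FinPlace F)} {h : G.FinGroup}
    (hh : h ∈ G.supportedOn (insert v S)) :
    ∃ h' ∈ G.supportedOn S, h = G.localEmb v (G.component v h) * h' := by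
  refine ⟨(G.localEmb v (G.component v h))⁻¹ * h, mem_supportedOn.2 fun w hw => ?_, by group⟩
  rw [map_mul, map_inv]
  by_cases hwv : w = v
  · subst hwv
    rw [component_localEmb_same, inv_mul_cancel]
  · rw [component_localEmb_ne hwv, mem_supportedOn.1 hh w (by simp [hwv, hw]), inv_one, one_mul]

/-- The truncation is assembled as a product of local embeddings, one place at a time, so that it
lies in G(𝔸_f) automatically. -/
theorem exists_truncation (h : G.FinGroup) (S : Finset (FinPlace F)) :
    ∃ u ∈ G.supportedOn (S : Set (FinPlace F)), ∀ w ∈ S, G.component w u = G.component w h := by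
  classical
  induction S using Finset.induction_on with
  | empty => exact ⟨1, OneMemClass.one_mem _, by simp⟩
  | insert v S hv ih =>
    obtain ⟨u, hu, huS⟩ := ih
    refine ⟨G.localEmb v (G.component v h) * u, MulMemClass.mul_mem ?_ ?_, fun w hw => ?_⟩
    · exact supportedOn_mono (by simp) (localEmb_mem_supportedOn v _)
    · exact supportedOn_mono (by simp) hu
    · rw [map_mul]
      by_cases hwv : w = v
      · subst hwv
        rw [component_localEmb_same, mem_supportedOn.1 hu w (by simpa using hv), mul_one]
      · rw [component_localEmb_ne hwv, one_mul, huS w (Finset.mem_of_mem_insert_of_ne hw hwv)]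

/-- Every element of `G(𝔸_f)` is approximated by elements supported on a finite set of places. -/
theorem exists_supportedOn_inv_mul_mem (h : G.FinGroup) {U : Subgroup G.FinGroup}
    (hU : IsOpen (U : Set G.FinGroup)) :
    ∃ (S : Finset (FinPlace F)) (u : G.FinGroup),
      u ∈ G.supportedOn (S : Set (FinPlace F)) ∧ u⁻¹ * h ∈ U := by
  choose T hT hTS using exists_truncation h
  -- Outside S the entries are those of the identity matrix, hence integral, and `tendsto_finAdele`
  -- applies.
  have entry : ∀ {g : G.FinGroup} {t : Finset (FinPlace F) → G.FinGroup},
      (∀ S : Finset (FinPlace F), t S ∈ G.supportedOn (S : Set (FinPlace F))) →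
      (∀ S : Finset (FinPlace F), ∀ w ∈ S, G.component w (t S) = G.component w g) →
      Filter.Tendsto (fun S => (t S).1.val) Filter.atTop (nhds g.1.val) := by
    intro g t ht htS
    refine tendsto_pi_nhds.2 fun i => tendsto_pi_nhds.2 fun j => tendsto_finAdele ?_ ?_
    · intro S w hw
      exact congrArg (fun a : G.LocalGroup w => a.1.val i j) (htS S w hw)
    · intro S w hw
      have : (t S).1.val i j w = (1 : Matrix (Fin n) (Fin n) (LocalField F w)) i j :=
        congrArg (fun a : G.LocalGroup w => a.1.val i j) (mem_supportedOn.1 (ht S) w hw)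
      rw [this, Matrix.one_apply]
      split_ifs
      exacts [OneMemClass.one_mem _, zero_mem _]
  have hlim : Filter.Tendsto T Filter.atTop (nhds h) := by
    -- Convergence in a unit group also requires convergence of the inverses, which are truncations
    -- of h⁻¹.
    have hinv : Filter.Tendsto (fun S => (T S)⁻¹.1.val) Filter.atTop (nhds h⁻¹.1.val) :=
      entry (g := h⁻¹) (t := fun S => (T S)⁻¹) (fun S => InvMemClass.inv_mem (hT S)) fun S w hw => by
        rw [map_inv, map_inv, hTS S w hw]
    refine tendsto_subtype_rng.2 (Units.isEmbedding_embedProduct.tendsto_nhds_iff.2 ?_)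
    exact Filter.Tendsto.prodMk_nhds (entry hT hTS) ((MulOpposite.continuous_op.tendsto _).comp hinv)
  have hlim' : Filter.Tendsto (fun S => (T S)⁻¹ * h) Filter.atTop (nhds (h⁻¹ * h)) :=
    hlim.inv.mul_const h
  rw [inv_mul_cancel] at hlim'
  obtain ⟨S, hS⟩ := (hlim'.eventually_mem (hU.mem_nhds (OneMemClass.one_mem U))).exists
  exact ⟨S, T S, hT S, hS⟩

end FiniteComponents

end LinAlgGroup

/-! ### Finite coset sums in a group with a compact open subgroup -/

section QuotientSums

variable {H : Type*} [Group H]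

/-- Sums over a coset space of a function on the group that is right invariant under the subgroup
are left invariant. -/
theorem sum_quotient_out_mul {L : Subgroup H} [Fintype (H ⧸ L)] {A : Type*} [AddCommMonoid A]
    {T : H → A} (hT : ∀ k, ∀ l ∈ L, T (k * l) = T k) (a : H) :
    ∑ q : H ⧸ L, T (a * q.out) = ∑ q : H ⧸ L, T q.out := by
  refine Fintype.sum_equiv (MulAction.toPerm a) _ _ fun q => ?_
  have h : (QuotientGroup.mk (a * q.out) : H ⧸ L) = QuotientGroup.mk (a • q).out := by
    rw [QuotientGroup.out_eq', ← smul_eq_mul, ← MulAction.Quotient.smul_mk, QuotientGroup.out_eq']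
  have := hT (a * q.out) _ (QuotientGroup.eq.1 h)
  rw [mul_inv_cancel_left] at this
  exact this.symm

/-- A compact open subgroup has a finite index subgroup that finitely many given conjugations map
into it. -/
theorem exists_finite_quotient_conj_mem [TopologicalSpace H] [IsTopologicalGroup H]
    {K : Subgroup H} (hK : IsOpen (K : Set H)) (hKc : IsCompact (K : Set H)) {ι : Type*} [Finite ι]
    (h : ι → H) :
    ∃ L : Subgroup K, Finite (K ⧸ L) ∧ ∀ i, ∀ l ∈ L, (h i)⁻¹ * l.1 * h i ∈ K := by
  -- L is the intersection of K with all h_i K h_i⁻¹: an open subgroup of a compact group, hence of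
  -- finite index.
  refine ⟨⨅ i, K.comap ((MulAut.conj (h i)⁻¹).toMonoidHom.comp K.subtype), ?_, fun i l hl => ?_⟩
  · have : CompactSpace K := isCompact_iff_compactSpace.1 hKc
    refine Subgroup.quotient_finite_of_isOpen _ ?_
    rw [Subgroup.coe_iInf]
    refine isOpen_iInter_of_finite fun i => ?_
    have hc : Continuous fun k : K => (h i)⁻¹ * k.1 * h i := by fun_prop
    convert hK.preimage hc
    ext k
    simp
  · simpa using Subgroup.mem_iInf.1 hl i

end QuotientSums

namespace LinAlgGroup

/-! ### Hecke operators as finite averages of translates -/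

section HeckeAverages

variable {F : Type u} [Field F] [NumberField F] {n : ℕ} {G : LinAlgGroup F n}

section Local

variable {v : FinPlace F} {K : Subgroup (G.LocalGroup v)}

open Classical in
/-- The sum of the characteristic functions of the cosets `khK`, for `k` in a system of
representatives of `K / L`. -/
noncomputable def cosetSum (L : Subgroup K) [Fintype (K ⧸ L)] (h : G.LocalGroup v)
    (g : G.LocalGroup v) : ℂ :=
  ∑ q : K ⧸ L, if (q.out.1 * h)⁻¹ * g ∈ K then 1 else 0

/-- Since h⁻¹Lh ⊆ K, the coset khK depends only on kL, so left multiplication by K permutes the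
summands. Right K-invariance is immediate and gives local constancy, as K is open. The support lies
in finitely many translates of the compact set K. -/
theorem isHeckeFunction_cosetSum (hK : IsOpen (K : Set (G.LocalGroup v)))
    (hKc : IsCompact (K : Set (G.LocalGroup v))) {L : Subgroup K} [Fintype (K ⧸ L)]
    {h : G.LocalGroup v} (hL : ∀ l ∈ L, h⁻¹ * l.1 * h ∈ K) :
    G.IsHeckeFunction K (cosetSum L h) := by
  classical
  have hright : ∀ k ∈ K, ∀ g, cosetSum L h (g * k) = cosetSum L h g := by
    intro k hk g
    simp only [cosetSum, ← mul_assoc, K.mul_mem_cancel_right hk]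
  refine ⟨?_, ?_, fun k hk g => ?_, hright⟩
  · rw [IsLocallyConstant.iff_eventually_eq]
    intro g
    have hopen : IsOpen ((fun y => g⁻¹ * y) ⁻¹' (K : Set (G.LocalGroup v))) :=
      hK.preimage (continuous_const_mul _)
    filter_upwards [hopen.mem_nhds (by simp : g⁻¹ * g ∈ (K : Set (G.LocalGroup v)))] with y hy
    simpa using hright _ hy g
  · refine HasCompactSupport.intro'
      (K := ⋃ q : K ⧸ L, (Homeomorph.mulLeft (q.out.1 * h)) '' (K : Set (G.LocalGroup v)))
      (isCompact_iUnion fun q => hKc.image (Homeomorph.continuous _))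
      (isClosed_iUnion_of_finite fun q => (Homeomorph.isClosedMap _) _
        (Subgroup.isClosed_of_isOpen K hK)) fun g hg => ?_
    refine Finset.sum_eq_zero fun q _ => if_neg fun hq => hg ?_
    exact Set.mem_iUnion.2 ⟨q, _, hq, mul_inv_cancel_left _ _⟩
  · have := sum_quotient_out_mul (L := L)
      (T := fun k : K => if (k.1 * h)⁻¹ * g ∈ K then (1 : ℂ) else 0) (fun k l hl => ?_) ⟨k, hk⟩⁻¹
    · rw [cosetSum, cosetSum, ← this]
      simp [mul_assoc]
    · have e : ((k * l : K).1 * h)⁻¹ * g = (h⁻¹ * l.1 * h)⁻¹ * ((k.1 * h)⁻¹ * g) := by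
        simp [mul_assoc]
      simp only [e, K.mul_mem_cancel_left (K.inv_mem (hL l hl))]

/-- On the coset khK the function g ↦ Φ(xg) is constant because Φ is K-invariant, and each such
coset has measure ν(K) by left invariance. -/
theorem heckeAction_cosetSum [MeasurableSpace (G.LocalGroup v)] [BorelSpace (G.LocalGroup v)]
    (ν : Measure (G.LocalGroup v)) [ν.IsHaarMeasure] (hK : IsOpen (K : Set (G.LocalGroup v)))
    (hKc : IsCompact (K : Set (G.LocalGroup v))) {L : Subgroup K} [Fintype (K ⧸ L)]
    {h : G.LocalGroup v} {Φ : G.Adelic → ℂ}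
    (hΦ : ∀ k ∈ K, G.rightTranslate (1, G.localEmb v k) Φ = Φ) :
    G.heckeAction ν (cosetSum L h) Φ = (ν.real K : ℂ) •
      ∑ q : K ⧸ L, G.rightTranslate (1, G.localEmb v (q.out.1 * h)) Φ := by
  classical
  funext x
  let B : K ⧸ L → Set (G.LocalGroup v) := fun q =>
    (fun g => (q.out.1 * h)⁻¹ * g) ⁻¹' (K : Set (G.LocalGroup v))
  have hB : ∀ q, MeasurableSet (B q) := fun q =>
    (hK.preimage (continuous_const_mul _)).measurableSet
  have hνB : ∀ q, ν (B q) = ν K := fun q => measure_preimage_mul ν _ _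
  have hK_fin : ν K ≠ ⊤ := hKc.measure_lt_top.ne
  have e : ∀ g, cosetSum L h g * Φ (x * (1, G.localEmb v g)) = ∑ q : K ⧸ L,
      (B q).indicator (fun _ => Φ (x * (1, G.localEmb v (q.out.1 * h)))) g := by
    intro g
    rw [cosetSum, Finset.sum_mul]
    refine Finset.sum_congr rfl fun q _ => ?_
    by_cases hq : (q.out.1 * h)⁻¹ * g ∈ K
    · rw [Set.indicator_of_mem (show g ∈ B q from hq), if_pos hq, one_mul]
      have := congrFun (hΦ _ hq) (x * (1, G.localEmb v (q.out.1 * h)))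
      rw [← this, rightTranslate, mul_assoc x,
        Prod.mk_mul_mk 1 1 (G.localEmb v (q.out.1 * h)), ← map_mul, mul_inv_cancel_left, one_mul]
    · rw [Set.indicator_of_notMem (show g ∉ B q from hq), if_neg hq, zero_mul]
  simp only [heckeAction, e]
  rw [integral_finsetSum _ fun q _ => (integrable_indicator_iff (hB q)).2
    (integrableOn_const (by rw [hνB]; exact hK_fin))]
  simp only [integral_indicator_const _ (hB _), Measure.real, hνB, Pi.smul_apply, Finset.sum_apply,
    rightTranslate, Finset.mul_sum, Complex.real_smul, smul_eq_mul]

/-- Averaging over a suitable finite subset of `K` maps finitely many given translates of a Hecke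
eigenvector to multiples of it. -/
theorem exists_local_average [MeasurableSpace (G.LocalGroup v)] [BorelSpace (G.LocalGroup v)]
    (ν : Measure (G.LocalGroup v)) [ν.IsHaarMeasure] (hK : IsOpen (K : Set (G.LocalGroup v)))
    (hKc : IsCompact (K : Set (G.LocalGroup v))) {Φ : G.Adelic → ℂ}
    (hΦ : ∀ k ∈ K, G.rightTranslate (1, G.localEmb v k) Φ = Φ) (hΦK : G.IsHeckeEigenvector ν K Φ)
    {ι : Type*} [Finite ι] (h : ι → G.LocalGroup v) :
    ∃ (J : Type u) (_ : Fintype J) (_ : Nonempty J) (k : J → G.LocalGroup v), (∀ j, k j ∈ K) ∧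
      ∀ i, ∃ c : ℂ, ∑ j, G.rightTranslate (1, G.localEmb v (k j * h i)) Φ = c • Φ := by
  obtain ⟨L, _, hL⟩ := exists_finite_quotient_conj_mem hK hKc h
  let _ := Fintype.ofFinite (K ⧸ L)
  refine ⟨K ⧸ L, inferInstance, inferInstance, fun q => q.out.1, fun q => q.out.2, fun i => ?_⟩
  obtain ⟨c, hc⟩ := hΦK.2 _ (isHeckeFunction_cosetSum hK hKc (hL i))
  rw [heckeAction_cosetSum ν hK hKc hΦ] at hc
  have hne : (ν.real K : ℂ) ≠ 0 := by
    rw [Complex.ofReal_ne_zero, Measure.real, ENNReal.toReal_ne_zero]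
    exact ⟨(hK.measure_pos ν ⟨1, K.one_mem⟩).ne', hKc.measure_lt_top.ne⟩
  exact ⟨(ν.real K : ℂ)⁻¹ * c, by rw [mul_smul, ← hc, inv_smul_smul₀ hne]⟩

end Local

/-- Induction on S. Elements at different places commute, so with h_i = h_{i,v} h'_i one has k k'
h_i = (k h_{i,v})(k' h'_i). The sum over k' turns Φ into c'Φ by induction, and the sum over k then
gives cc'Φ. One family of k's must serve all h_i at once, since it will be applied to a whole linear
combination of translates. -/
theorem exists_average [∀ v, MeasurableSpace (G.LocalGroup v)] [∀ v, BorelSpace (G.LocalGroup v)]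
    (ν : ∀ v, Measure (G.LocalGroup v)) (hν : ∀ v, (ν v).IsHaarMeasure)
    {K : ∀ v, Subgroup (G.LocalGroup v)} (hK : ∀ v, IsOpen (K v : Set (G.LocalGroup v)))
    (hKc : ∀ v, IsCompact (K v : Set (G.LocalGroup v))) {Φ : G.Adelic → ℂ}
    (hΦ : ∀ v, ∀ k ∈ K v, G.rightTranslate (1, G.localEmb v k) Φ = Φ)
    (hΦK : ∀ v, G.IsHeckeEigenvector (ν v) (K v) Φ) {ι : Type*} [Finite ι]
    (S : Finset (FinPlace F)) (h : ι → G.FinGroup)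
    (hh : ∀ i, h i ∈ G.supportedOn (S : Set (FinPlace F))) :
    ∃ (J : Type u) (_ : Fintype J) (_ : Nonempty J) (k : J → G.FinGroup),
      (∀ j, k j ∈ G.supportedOn (S : Set (FinPlace F))) ∧
      (∀ j, G.rightTranslate (1, k j) Φ = Φ) ∧
      ∀ i, ∃ c : ℂ, ∑ j, G.rightTranslate (1, k j * h i) Φ = c • Φ := by
  classical
  induction S using Finset.induction_on generalizing h with
  | empty =>
    refine ⟨PUnit, inferInstance, inferInstance, fun _ => 1, fun _ => Subgroup.one_mem _, fun _ =>
      rightTranslate_one Φ, fun i => ⟨1, ?_⟩⟩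
    have : h i = 1 := fin_ext fun w => by
      rw [map_one]; exact mem_supportedOn.1 (hh i) w (by simp)
    simp only [this, Finset.univ_unique, Finset.sum_singleton, mul_one, one_smul]
    exact rightTranslate_one Φ
  | insert v S hv ih =>
    choose h' hh' hhh' using fun i => exists_eq_localEmb_mul (S := (S : Set (FinPlace F))) (v := v)
      (by simpa using hh i)
    obtain ⟨J', _, _, k', hk'S, hk'Φ, hk'⟩ := ih h' hh'
    have := hν v
    obtain ⟨J, _, _, k, hk, hkh⟩ := exists_local_average (ν v) (hK v) (hKc v) (hΦ v) (hΦK v)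
      fun i => G.component v (h i)
    refine ⟨J × J', inferInstance, inferInstance, fun j => G.localEmb v (k j.1) * k' j.2,
      fun j => ?_, fun j => ?_, fun i => ?_⟩
    · exact Subgroup.mul_mem _ (supportedOn_mono (by simp) (localEmb_mem_supportedOn v _))
        (supportedOn_mono (by simp) (hk'S j.2))
    · have := rightTranslate_rightTranslate (G := G) (1, G.localEmb v (k j.1)) (1, k' j.2) Φ
      rw [Prod.mk_mul_mk, one_mul] at this
      rw [← this, hk'Φ, hΦ v _ (hk j.1)]
    · obtain ⟨c, hc⟩ := hkh i
      obtain ⟨c', hc'⟩ := hk' i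
      refine ⟨c * c', ?_⟩
      have e : ∀ (j : J) (j' : J'), G.rightTranslate (1, G.localEmb v (k j) * k' j' * h i) Φ =
          G.rightTranslate (1, G.localEmb v (k j * G.component v (h i)))
            (G.rightTranslate (1, k' j' * h' i) Φ) := by
        intro j j'
        rw [rightTranslate_rightTranslate, Prod.mk_mul_mk, one_mul, map_mul]
        congr 2
        conv_lhs => rw [hhh' i]
        have := (localEmb_commute (by simpa using hv) (G.component v (h i)) (hk'S j')).eq
        simp only [mul_assoc]
        rw [← mul_assoc (k' j'), ← this, mul_assoc]
      have hlin : ∀ (y : G.Adelic) (a : J' → G.Adelic → ℂ),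
          ∑ j', G.rightTranslate y (a j') = G.rightTranslate y (∑ j', a j') := by
        intro y a
        funext x
        simp [rightTranslate]
      rw [Fintype.sum_prod_type]
      simp only [e, hlin, hc']
      have hs : ∀ y : G.Adelic, G.rightTranslate y (c' • Φ) = c' • G.rightTranslate y Φ :=
        fun _ => rfl
      simp only [hs, ← Finset.smul_sum, hc]
      rw [smul_smul, mul_comm]

end HeckeAverages

end LinAlgGroup

/-! ### Schur's lemma in countable dimension and submodules of sums of copies of a simple module -/

section CountableSchur

open Polynomial

variable {A M : Type*} [Ring A] [Algebra ℂ A] [AddCommGroup M] [Module ℂ M] [Module A M]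
  [IsScalarTower ℂ A M]

/-- If no polynomial in the endomorphism `T` kills `v`, the vectors `(T - c)⁻¹ v` are linearly
independent. -/
theorem linearIndependent_of_sub_smul_apply {V : Type*} [AddCommGroup V] [Module ℂ V]
    {T : Module.End ℂ V} {v : V} (hv : ∀ p : ℂ[X], aeval T p v = 0 → p = 0) {u : ℂ → V}
    (hu : ∀ c, T (u c) - c • u c = v) : LinearIndependent ℂ u := by
  classical
  refine linearIndependent_iff'.2 fun s a ha i hi => ?_
  -- The numerator of Σ a_j / (X - j) over a common denominator; evaluating it at i isolates a_i.
  let p : ℂ[X] := ∑ j ∈ s, C (a j) * ∏ k ∈ s.erase j, (X - C k)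
  have h1 : ∀ j ∈ s, aeval T (∏ k ∈ s, (X - C k)) (u j) = aeval T (∏ k ∈ s.erase j, (X - C k)) v := by
    intro j hj
    rw [← Finset.prod_erase_mul _ _ hj, map_mul, Module.End.mul_apply]
    congr 1
    rw [← hu j]
    simp
  have hp : p = 0 := by
    refine hv p ?_
    have := congrArg (aeval T (∏ k ∈ s, (X - C k))) ha
    rw [map_zero, map_sum] at this
    rw [← this, map_sum, LinearMap.sum_apply]
    refine Finset.sum_congr rfl fun j hj => ?_
    rw [map_smul, h1 j hj, map_mul, Module.End.mul_apply, aeval_C]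
    rfl
  have hi0 := congrArg (eval i) hp
  rw [eval_zero, eval_finsetSum, Finset.sum_eq_single_of_mem i hi fun j hj hne => ?_] at hi0
  · rw [eval_mul, eval_C, eval_prod] at hi0
    refine (mul_eq_zero.1 hi0).resolve_right (Finset.prod_ne_zero_iff.2 fun k hk => ?_)
    simpa [sub_eq_zero] using (Finset.ne_of_mem_erase hk).symm
  · rw [eval_mul, eval_prod, Finset.prod_eq_zero (Finset.mem_erase.2 ⟨hne.symm, hi⟩) (by simp),
      mul_zero]

/-- **Dixmier's lemma**: the endomorphisms of a simple module of countable dimension over a complex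
algebra are scalars. -/
theorem exists_eq_smul_of_rank_le_aleph0 [IsSimpleModule A M]
    (hM : Module.rank ℂ M ≤ Cardinal.aleph0) (T : Module.End A M) :
    ∃ c : ℂ, ∀ m, T m = c • m := by
  have : SMulCommClass A ℂ M := SMulCommClass.symm ℂ A M
  by_contra! hT
  -- If T is no scalar, every T - c is nonzero, hence bijective on the simple module, and T has
  -- empty spectrum.
  have hbij : ∀ c : ℂ, Function.Bijective (T - algebraMap ℂ (Module.End A M) c) := by
    intro c
    refine LinearMap.bijective_of_ne_zero fun h => ?_
    obtain ⟨m, hm⟩ := hT c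
    exact hm (sub_eq_zero.1 (by simpa using LinearMap.congr_fun h m))
  have hspec : spectrum ℂ T = ∅ := by
    refine Set.eq_empty_of_forall_notMem fun c hc => ?_
    rw [spectrum.mem_iff, IsUnit.sub_iff] at hc
    exact hc ((Module.End.isUnit_iff _).2 (hbij c))
  have : Nontrivial M := IsSimpleModule.nontrivial A M
  obtain ⟨v, hv⟩ := exists_ne (0 : M)
  let Tc : Module.End ℂ M := T.restrictScalars ℂ
  have haeval : ∀ p : ℂ[X], aeval Tc p = (aeval T p).restrictScalars ℂ := by
    intro p
    induction p using Polynomial.induction_on' with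
    | add p q hp hq => rw [map_add, map_add, hp, hq]; rfl
    | monomial k a =>
      rw [aeval_monomial, aeval_monomial]
      ext m
      have : ∀ k : ℕ, ∀ m, (Tc ^ k) m = (T ^ k) m := by
        intro k
        induction k with
        | zero => intro m; rfl
        | succ k ih => intro m; rw [pow_succ, pow_succ, Module.End.mul_apply, ih]; rfl
      simp [this]
  -- By spectral mapping a nonconstant polynomial in T also has empty spectrum, so it is invertible
  -- and cannot kill v; nonzero constants are units anyway.
  have hker : ∀ p : ℂ[X], aeval Tc p v = 0 → p = 0 := by
    intro p hp
    by_contra hne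
    have hunit : IsUnit (aeval T p) := by
      rcases Nat.eq_zero_or_pos p.natDegree with h0 | hpos
      · rw [Polynomial.eq_C_of_natDegree_eq_zero h0, aeval_C]
        refine IsUnit.map _ (IsUnit.mk0 _ fun h => hne ?_)
        rw [Polynomial.eq_C_of_natDegree_eq_zero h0, h, C_0]
      · have := spectrum.map_polynomial_aeval_of_degree_pos T p
          (Polynomial.natDegree_pos_iff_degree_pos.1 hpos)
        rw [hspec, Set.image_empty] at this
        by_contra hu
        exact (this ▸ (spectrum.zero_mem_iff ℂ).2 hu : (0 : ℂ) ∈ (∅ : Set ℂ))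
    rw [haeval] at hp
    exact hv (((Module.End.isUnit_iff _).1 hunit).1 (hp.trans (map_zero _).symm))
  -- The vectors (T - c)⁻¹v, for c ∈ ℂ, form a linearly independent family of the cardinality of the
  -- continuum.
  choose u hu using fun c => (hbij c).2 v
  have hli := linearIndependent_of_sub_smul_apply (T := Tc) (v := v) (u := u) hker
    fun c => by simpa [Tc] using hu c
  have h1 := hli.cardinal_lift_le_rank
  have h2 := h1.trans (Cardinal.lift_le.2 hM)
  rw [Cardinal.mk_complex, Cardinal.lift_continuum, Cardinal.lift_aleph0] at h2
  exact (Cardinal.aleph0_lt_continuum.trans_le h2).false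

/-- A nonzero submodule of a sum of images of a simple module `M` of countable dimension contains
a nonzero linear combination of the images of any nonzero vector of `M`. -/
theorem exists_mem_ne_zero_mem_span {S : Type*} [AddCommGroup S] [Module ℂ S] [Module A S]
    [IsScalarTower ℂ A S] {M : Submodule A S} [IsSimpleModule A M]
    (hM : Module.rank ℂ M ≤ Cardinal.aleph0) {ι : Type*} (τ : ι → S →ₗ[A] S)
    {W : Submodule A S} (hW : W ≤ ⨆ i, M.map (τ i)) (hW0 : W ≠ ⊥) {Φ : S} (hΦ : Φ ∈ M)
    (hΦ0 : Φ ≠ 0) :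
    ∃ w ∈ W, w ≠ 0 ∧ w ∈ Submodule.span ℂ (Set.range fun i => τ i Φ) := by
  classical
  let p : (ι →₀ M) →ₗ[A] S := Finsupp.lsum ℕ fun i => τ i ∘ₗ M.subtype
  have hp : W ≤ LinearMap.range p := by
    refine hW.trans (iSup_le fun i => ?_)
    rintro _ ⟨m, hm, rfl⟩
    exact ⟨Finsupp.single i ⟨m, hm⟩, by simp [p]⟩
  -- The direct sum of copies of M is semisimple, so W lifts back into it; being embedded there, W
  -- is itself semisimple.
  obtain ⟨s, hs⟩ := IsSemisimpleModule.lifting_property p.rangeRestrict p.surjective_rangeRestrict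
    (Submodule.inclusion hp)
  have hps : ∀ w : W, p (s w) = w := fun w => congrArg Subtype.val (LinearMap.congr_fun hs w)
  have hsinj : Function.Injective s := fun w w' h => Subtype.ext (by rw [← hps, h, hps])
  have : IsSemisimpleModule A W := IsSemisimpleModule.of_injective s hsinj
  obtain ⟨w, hwW, hw0⟩ := W.ne_bot_iff.1 hW0
  have hsw : s ⟨w, hwW⟩ ≠ 0 := fun h => hw0 (by
    simpa [h] using (hps ⟨w, hwW⟩).symm)
  obtain ⟨a, ha⟩ := Finsupp.ne_iff.1 hsw
  let π : W →ₗ[A] M := Finsupp.lapply a ∘ₗ s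
  have hπ : π ≠ 0 := fun h => ha (LinearMap.congr_fun h ⟨w, hwW⟩)
  -- A nonzero coordinate of the lift maps W onto the simple module M; a splitting j embeds M in W,
  -- and j(Φ) is the vector sought.
  obtain ⟨j, hj⟩ := IsSemisimpleModule.lifting_property π (LinearMap.surjective_of_ne_zero hπ)
    LinearMap.id
  refine ⟨j ⟨Φ, hΦ⟩, (j ⟨Φ, hΦ⟩).2, fun h => hΦ0 ?_, ?_⟩
  · have h1 := LinearMap.congr_fun hj ⟨Φ, hΦ⟩
    rw [LinearMap.comp_apply, Subtype.ext (a2 := (0 : W)) h, map_zero] at h1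
    exact (congrArg Subtype.val h1).symm
  · rw [← hps]
    have hsum : p (s (j ⟨Φ, hΦ⟩)) = (s (j ⟨Φ, hΦ⟩)).sum fun i m => τ i m := rfl
    rw [hsum]
    refine Submodule.sum_mem _ fun i _ => ?_
    -- Each coordinate of s ∘ j is an endomorphism of M, hence a scalar.
    obtain ⟨c, hc⟩ := exists_eq_smul_of_rank_le_aleph0 hM (Finsupp.lapply i ∘ₗ s ∘ₗ j)
    have hci : s (j ⟨Φ, hΦ⟩) i = c • (⟨Φ, hΦ⟩ : M) := hc ⟨Φ, hΦ⟩
    have : τ i ((s (j ⟨Φ, hΦ⟩) i : M) : S) = c • τ i Φ := by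
      rw [hci, ← LinearMap.map_smul_of_tower]; rfl
    dsimp only
    rw [this]
    exact Submodule.smul_mem _ _ (Submodule.subset_span ⟨i, rfl⟩)

end CountableSchur

/-! ### The Petersson inner product on functions equivariant under Γ -/

section QuotientPairing

open ComplexConjugate

variable {H : Type*} [Group H] [TopologicalSpace H] {Γ : Subgroup H}

/-- The quotient of `H` by left translation by `Γ`. -/
abbrev LeftQuotient {H : Type*} [Group H] (Γ : Subgroup H) := Quotient (QuotientGroup.rightRel Γ)

/-- The pairing of two functions `f`, `f'` such that `f * conj f'` is left invariant, as a function
on the quotient. -/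
noncomputable def quotientPairing (f f' : H → ℂ) (q : LeftQuotient Γ) : ℂ := f q.out * conj (f' q.out)

variable (Γ) in
/-- The continuous functions on `H` that transform under left translation by `Γ` according to
`ψ` and whose square is integrable on the quotient. -/
structure IsL2Form [MeasurableSpace (LeftQuotient Γ)] (ψ : Γ → ℂ)
    (μ : Measure (LeftQuotient Γ)) (f : H → ℂ) : Prop where
  continuous : Continuous f
  apply_mul : ∀ (γ : Γ) (x : H), f (γ * x) = ψ γ * f x
  lintegral_lt_top : ∫⁻ q : LeftQuotient Γ, ‖f q.out‖ₑ ^ 2 ∂μ < ⊤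

omit [TopologicalSpace H] in
theorem exists_out_mk_eq (x : H) :
    ∃ γ : Γ, (Quotient.mk (QuotientGroup.rightRel Γ) x).out = γ * x := by
  have h : (QuotientGroup.rightRel Γ) x (Quotient.mk (QuotientGroup.rightRel Γ) x).out :=
    (QuotientGroup.rightRel Γ).symm (Quotient.mk_out (s := QuotientGroup.rightRel Γ) x)
  rw [QuotientGroup.rightRel_apply] at h
  exact ⟨⟨_, h⟩, by simp⟩

variable [MeasurableSpace (LeftQuotient Γ)] {ψ : Γ → ℂ} {μ : Measure (LeftQuotient Γ)} {f f' : H → ℂ}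

namespace IsL2Form

/-- Changing the representative multiplies the pairing by |ψ(γ)|² = 1. Continuity and translation
properties can thus be checked on H, although the pairing is defined through arbitrary
representatives. -/
theorem quotientPairing_mk (hψ : ∀ γ, ‖ψ γ‖ = 1) (hf : IsL2Form Γ ψ μ f) (hf' : IsL2Form Γ ψ μ f')
    (x : H) : quotientPairing f f' (Quotient.mk (QuotientGroup.rightRel Γ) x) = f x * conj (f' x) := by
  obtain ⟨γ, hγ⟩ := exists_out_mk_eq (Γ := Γ) x
  have h1 : ψ γ * conj (ψ γ) = 1 := by
    rw [Complex.mul_conj, Complex.normSq_eq_norm_sq, hψ]; simp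
  rw [quotientPairing, hγ, hf.apply_mul, hf'.apply_mul, map_mul]
  linear_combination (f x * conj (f' x)) * h1

theorem continuous_quotientPairing (hψ : ∀ γ, ‖ψ γ‖ = 1) (hf : IsL2Form Γ ψ μ f)
    (hf' : IsL2Form Γ ψ μ f') : Continuous (quotientPairing f f' : LeftQuotient Γ → ℂ) := by
  refine isQuotientMap_quot_mk.continuous_iff.2 ?_
  have : Continuous fun x => f x * conj (f' x) :=
    hf.continuous.mul (Complex.continuous_conj.comp hf'.continuous)
  exact this.congr fun x => (quotientPairing_mk hψ hf hf' x).symm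

theorem enorm_mk (hψ : ∀ γ, ‖ψ γ‖ = 1) (hf : IsL2Form Γ ψ μ f) (x : H) :
    ‖f (Quotient.mk (QuotientGroup.rightRel Γ) x).out‖ₑ = ‖f x‖ₑ := by
  obtain ⟨γ, hγ⟩ := exists_out_mk_eq (Γ := Γ) x
  rw [hγ, hf.apply_mul, enorm_mul, ← ofReal_norm (ψ γ), hψ, ENNReal.ofReal_one, one_mul]

theorem continuous_enorm (hψ : ∀ γ, ‖ψ γ‖ = 1) (hf : IsL2Form Γ ψ μ f) :
    Continuous fun q : LeftQuotient Γ => ‖f q.out‖ₑ := by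
  refine isQuotientMap_quot_mk.continuous_iff.2 ?_
  have : Continuous fun x => ‖f x‖ₑ := hf.continuous.enorm
  exact this.congr fun x => (enorm_mk hψ hf x).symm

variable [BorelSpace (LeftQuotient Γ)]

theorem integrable_quotientPairing (hψ : ∀ γ, ‖ψ γ‖ = 1) (hf : IsL2Form Γ ψ μ f)
    (hf' : IsL2Form Γ ψ μ f') : Integrable (quotientPairing f f' : LeftQuotient Γ → ℂ) μ := by
  refine ⟨(continuous_quotientPairing hψ hf hf').aestronglyMeasurable, ?_⟩
  refine lt_of_le_of_lt (lintegral_mono (g := fun q : LeftQuotient Γ => ‖f q.out‖ₑ ^ 2 + ‖f' q.out‖ₑ ^ 2)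
    fun q => ?_) ?_
  · rw [quotientPairing, enorm_mul, ← ofReal_norm (conj _), RCLike.norm_conj, ofReal_norm]
    rcases le_total ‖f q.out‖ₑ ‖f' q.out‖ₑ with h | h
    · refine le_trans ?_ le_add_self
      rw [sq]
      gcongr
    · refine le_trans ?_ le_self_add
      rw [sq]
      gcongr
  · rw [lintegral_add_left ((continuous_enorm hψ hf).measurable.pow_const 2)]
    exact ENNReal.add_lt_top.2 ⟨hf.lintegral_lt_top, hf'.lintegral_lt_top⟩

omit [BorelSpace (LeftQuotient Γ)] in
theorem zero : IsL2Form Γ ψ μ (0 : H → ℂ) :=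
  ⟨continuous_const, by simp, by simp⟩

theorem add (hψ : ∀ γ, ‖ψ γ‖ = 1) (hf : IsL2Form Γ ψ μ f) (hf' : IsL2Form Γ ψ μ f') :
    IsL2Form Γ ψ μ (f + f') := by
  refine ⟨hf.continuous.add hf'.continuous, fun γ x => ?_, ?_⟩
  · simp only [Pi.add_apply, hf.apply_mul, hf'.apply_mul, mul_add]
  · refine lt_of_le_of_lt (lintegral_mono
      (g := fun q : LeftQuotient Γ => 2 * (‖f q.out‖ₑ ^ 2 + ‖f' q.out‖ₑ ^ 2)) fun q => ?_) ?_
    · have h1 : ‖(f + f') q.out‖ₑ ≤ ‖f q.out‖ₑ + ‖f' q.out‖ₑ := enorm_add_le _ _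
      refine (pow_le_pow_left₀ zero_le h1 2).trans ?_
      have h2 := ENNReal.rpow_add_le_mul_rpow_add_rpow ‖f q.out‖ₑ ‖f' q.out‖ₑ
        (p := 2) (by norm_num)
      norm_num at h2
      exact h2
    · have hm := (continuous_enorm hψ hf).measurable.pow_const 2
      rw [lintegral_const_mul' _ _ (by norm_num), lintegral_add_left hm]
      exact ENNReal.mul_lt_top (by norm_num)
        (ENNReal.add_lt_top.2 ⟨hf.lintegral_lt_top, hf'.lintegral_lt_top⟩)

omit [BorelSpace (LeftQuotient Γ)] in
theorem const_smul (hf : IsL2Form Γ ψ μ f) (c : ℂ) :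
    IsL2Form Γ ψ μ (c • f) := by
  refine ⟨hf.continuous.const_smul c, fun γ x => ?_, ?_⟩
  · simp only [Pi.smul_apply, hf.apply_mul, smul_eq_mul]; ring
  · simp only [Pi.smul_apply, enorm_smul, mul_pow]
    rw [lintegral_const_mul' _ _ (by simp)]
    exact ENNReal.mul_lt_top (by simp) hf.lintegral_lt_top

end IsL2Form

/-- The square-integrable functions with prescribed left transformation behaviour. -/
def l2Forms [BorelSpace (LeftQuotient Γ)] (μ : Measure (LeftQuotient Γ)) (hψ : ∀ γ : Γ, ‖ψ γ‖ = 1) :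
    Submodule ℂ (H → ℂ) where
  carrier := {f | IsL2Form Γ ψ μ f}
  zero_mem' := IsL2Form.zero
  add_mem' h h' := h.add hψ h'
  smul_mem' c _ h := h.const_smul c

/-- The Petersson inner product. -/
noncomputable def petersson (μ : Measure (LeftQuotient Γ)) (f f' : H → ℂ) : ℂ :=
  ∫ q : LeftQuotient Γ, quotientPairing f f' q ∂μ

omit [TopologicalSpace H] in
theorem petersson_conj (f f' : H → ℂ) : conj (petersson μ f f') = petersson μ f' f := by
  rw [petersson, ← integral_conj]
  refine integral_congr_ae (Filter.Eventually.of_forall fun q => ?_)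
  simp [quotientPairing, mul_comm]

omit [TopologicalSpace H] in
theorem petersson_const_smul (c : ℂ) (f f' : H → ℂ) :
    petersson μ (c • f) f' = c * petersson μ f f' := by
  rw [petersson, petersson, ← integral_const_mul]
  refine integral_congr_ae (Filter.Eventually.of_forall fun q => ?_)
  simp [quotientPairing, mul_assoc]

variable [BorelSpace (LeftQuotient Γ)]

theorem petersson_add (hψ : ∀ γ, ‖ψ γ‖ = 1) {f₁ f₂ : H → ℂ} (h₁ : IsL2Form Γ ψ μ f₁)
    (h₂ : IsL2Form Γ ψ μ f₂) (hf : IsL2Form Γ ψ μ f) :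
    petersson μ (f₁ + f₂) f = petersson μ f₁ f + petersson μ f₂ f := by
  rw [petersson, petersson, petersson, ← integral_add
    (h₁.integrable_quotientPairing hψ hf) (h₂.integrable_quotientPairing hψ hf)]
  refine integral_congr_ae (Filter.Eventually.of_forall fun q => ?_)
  simp [quotientPairing, add_mul]

theorem petersson_sum (hψ : ∀ γ, ‖ψ γ‖ = 1) {ι : Type*} (s : Finset ι) {g : ι → H → ℂ}
    (hg : ∀ i, IsL2Form Γ ψ μ (g i)) (hf : IsL2Form Γ ψ μ f) :
    petersson μ (∑ i ∈ s, g i) f = ∑ i ∈ s, petersson μ (g i) f := by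
  classical
  induction s using Finset.induction_on with
  | empty => simp [petersson, quotientPairing]
  | insert a s ha ih =>
    rw [Finset.sum_insert ha, Finset.sum_insert ha, petersson_add hψ (hg a)
      ((l2Forms μ hψ).sum_mem fun i _ => hg i) hf, ih]

/-- A vanishing integral of |f|² forces f = 0 almost everywhere, and then everywhere by continuity,
because nonempty open sets have positive measure. -/
theorem petersson_self_ne_zero [μ.IsOpenPosMeasure] (hψ : ∀ γ, ‖ψ γ‖ = 1) (hf : IsL2Form Γ ψ μ f)
    (hf0 : f ≠ 0) : petersson μ f f ≠ 0 := by
  intro h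
  have e : ∀ q : LeftQuotient Γ, quotientPairing f f q = ((‖f q.out‖ ^ 2 : ℝ) : ℂ) := fun q => by
    rw [quotientPairing, Complex.mul_conj, Complex.normSq_eq_norm_sq]
  have hint := hf.integrable_quotientPairing hψ hf
  have hcont := hf.continuous_quotientPairing hψ hf
  simp only [petersson, e] at h
  rw [integral_complex_ofReal, Complex.ofReal_eq_zero] at h
  have hre : ∀ q : LeftQuotient Γ, (quotientPairing f f q).re = ‖f q.out‖ ^ 2 := fun q => by
    rw [e, Complex.ofReal_re]
  have hint' : Integrable (fun q : LeftQuotient Γ => ‖f q.out‖ ^ 2) μ :=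
    hint.re.congr (Filter.Eventually.of_forall hre)
  have hcont' : Continuous fun q : LeftQuotient Γ => ‖f q.out‖ ^ 2 :=
    (Complex.continuous_re.comp hcont).congr hre
  have h0 := (integral_eq_zero_iff_of_nonneg (fun q => by positivity) hint').1 h
  have h1 := (hcont'.ae_eq_iff_eq μ continuous_zero).1 h0
  refine hf0 (funext fun x => ?_)
  have h2 := congrFun h1 (Quotient.mk (QuotientGroup.rightRel Γ) x)
  have h3 := hf.quotientPairing_mk hψ hf x
  rw [e, show ‖f (Quotient.mk (QuotientGroup.rightRel Γ) x).out‖ ^ 2 = 0 from h2, Complex.mul_conj,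
    Complex.normSq_eq_norm_sq] at h3
  simpa using h3.symm

section Translation

variable {T : H → LeftQuotient Γ → LeftQuotient Γ}
  (hT : ∀ y x, T y (Quotient.mk (QuotientGroup.rightRel Γ) x) = Quotient.mk (QuotientGroup.rightRel Γ) (x * y))

include hT in
omit [BorelSpace (LeftQuotient Γ)] [MeasurableSpace (LeftQuotient Γ)] in
theorem continuous_of_mk [ContinuousMul H] (y : H) : Continuous (T y) := by
  refine isQuotientMap_quot_mk.continuous_iff.2 ?_
  have : Continuous fun x : H => (Quotient.mk (QuotientGroup.rightRel Γ) (x * y) : LeftQuotient Γ) :=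
    continuous_quotient_mk'.comp (continuous_mul_const y)
  exact this.congr fun x => (hT y x).symm

include hT in
/-- A nonzero invariant regular measure is positive on nonempty open sets. -/
theorem isOpenPosMeasure_of_map_eq [ContinuousMul H] [μ.Regular] (hμ0 : μ ≠ 0)
    (hμ : ∀ y, μ.map (T y) = μ) : μ.IsOpenPosMeasure := by
  refine ⟨fun U hU hne h0 => hμ0 ?_⟩
  -- By inner regularity it is enough that compact sets are null. Translations act transitively, so
  -- every point has a neighbourhood that is the preimage under a translation of the null open set
  -- U, and hence is null.
  rw [← Measure.measure_univ_eq_zero, isOpen_univ.measure_eq_iSup_isCompact]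
  simp only [ENNReal.iSup_eq_zero]
  intro C _ hC
  refine hC.measure_zero_of_nhdsWithin fun q _ => ?_
  obtain ⟨a, ha⟩ := hne
  obtain ⟨a, rfl⟩ := Quotient.exists_rep a
  obtain ⟨x, rfl⟩ := Quotient.exists_rep q
  have hc := continuous_of_mk hT (x⁻¹ * a)
  refine ⟨T (x⁻¹ * a) ⁻¹' U, mem_nhdsWithin_of_mem_nhds ((hU.preimage hc).mem_nhds ?_), ?_⟩
  · rw [Set.mem_preimage, hT, mul_inv_cancel_left]
    exact ha
  · rw [← Measure.map_apply hc.measurable hU.measurableSet, hμ, h0]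

include hT in
theorem IsL2Form.comp_mul_right [ContinuousMul H] (hμ : ∀ y, μ.map (T y) = μ)
    (hψ : ∀ γ, ‖ψ γ‖ = 1) (hf : IsL2Form Γ ψ μ f) (y : H) :
    IsL2Form Γ ψ μ fun x => f (x * y) := by
  refine ⟨hf.continuous.comp (continuous_mul_const y), fun γ x => ?_, ?_⟩
  · rw [mul_assoc, hf.apply_mul]
  · have h := hf.lintegral_lt_top
    rw [← hμ y, lintegral_map ((continuous_enorm hψ hf).measurable.pow_const 2)
      (continuous_of_mk hT y).measurable] at h
    convert h using 4 with q
    rw [← Quotient.out_eq q, hT, enorm_mk hψ hf, Quotient.out_eq]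

include hT in
-- Unitarity of right translation, by the change of variables q ↦ T y q.
theorem petersson_comp_mul_right [ContinuousMul H] (hμ : ∀ y, μ.map (T y) = μ)
    (hψ : ∀ γ, ‖ψ γ‖ = 1) (hf : IsL2Form Γ ψ μ f) (hf' : IsL2Form Γ ψ μ f') (y : H) :
    petersson μ (fun x => f (x * y)) (fun x => f' (x * y)) = petersson μ f f' := by
  conv_rhs => rw [petersson, ← hμ y, integral_map (continuous_of_mk hT y).aemeasurable
    (hf.continuous_quotientPairing hψ hf').aestronglyMeasurable]
  refine integral_congr_ae (Filter.Eventually.of_forall fun q => ?_)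
  dsimp only
  conv_rhs => rw [← Quotient.out_eq q, hT, hf.quotientPairing_mk hψ hf']
  rfl

end Translation

end QuotientPairing

/-! ### Conjugates and intersections of open compact subgroups -/

section OpenCompactSubgroups

variable {H : Type*} [Group H] [TopologicalSpace H] [IsTopologicalGroup H]

/-- K' is hKh⁻¹, which fixes the right translate by h of any function fixed by K. -/
theorem exists_open_compact_conj {K : Subgroup H} (hK : IsOpen (K : Set H))
    (hKc : IsCompact (K : Set H)) (h : H) :
    ∃ K' : Subgroup H, IsOpen (K' : Set H) ∧ IsCompact (K' : Set H) ∧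
      ∀ k ∈ K', h⁻¹ * k * h ∈ K := by
  refine ⟨K.comap (MulAut.conj h⁻¹).toMonoidHom, ?_, ?_, fun k hk => by simpa using hk⟩
  · have hc : Continuous fun k : H => h⁻¹ * k * h := by fun_prop
    convert hK.preimage hc
    ext k
    simp
  · have hc : Continuous fun k : H => h * k * h⁻¹ := by fun_prop
    convert hKc.image hc
    ext k
    simp only [Subgroup.coe_comap, Set.mem_preimage, Set.mem_image, SetLike.mem_coe]
    constructor
    · intro hk
      exact ⟨_, hk, by simp [mul_assoc]⟩
    · rintro ⟨y, hy, rfl⟩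
      simpa [mul_assoc] using hy

theorem exists_open_compact_le {K K' : Subgroup H} (hK : IsOpen (K : Set H))
    (hKc : IsCompact (K : Set H)) (hK' : IsOpen (K' : Set H)) :
    IsOpen ((K ⊓ K' : Subgroup H) : Set H) ∧ IsCompact ((K ⊓ K' : Subgroup H) : Set H) :=
  ⟨hK.inter hK', hKc.inter_right (K'.isClosed_of_isOpen hK')⟩

end OpenCompactSubgroups

namespace LinAlgGroup

variable {F : Type u} [Field F] [NumberField F] {n : ℕ} {G : LinAlgGroup F n}

/-! ### Stability of automorphic forms under the three actions -/

section AutomorphicForms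

theorem rightTranslate_arch_fin (a : G.ArchGroup) (b : G.FinGroup) (f : G.Adelic → ℂ) :
    G.rightTranslate (a, 1) (G.rightTranslate (1, b) f) =
      G.rightTranslate (1, b) (G.rightTranslate (a, 1) f) := by
  rw [rightTranslate_rightTranslate, rightTranslate_rightTranslate]
  congr 1
  ext1 <;> simp

/-- Right translation of functions as a linear map. -/
noncomputable def translateLinear (y : G.Adelic) : (G.Adelic → ℂ) →ₗ[ℂ] (G.Adelic → ℂ) :=
  LinearMap.funLeft ℂ ℂ (· * y)

/-- The span of the translates under `K_∞`. -/
noncomputable def compactSpan (Kinf : Subgroup G.ArchGroup) (f : G.Adelic → ℂ) :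
    Submodule ℂ (G.Adelic → ℂ) :=
  Submodule.span ℂ {g | ∃ k ∈ Kinf, g = G.rightTranslate (k, 1) f}

/-- The automorphic forms with central character `χ`. -/
structure IsAutomorphicFormWith (Kinf : Subgroup G.ArchGroup) (χ : G.adelicCenter →ₜ* Circle)
    (f : G.Adelic → ℂ) : Prop where
  finite_smooth : ∃ Kf : Subgroup G.FinGroup, IsOpen (Kf : Set G.FinGroup) ∧
    IsCompact (Kf : Set G.FinGroup) ∧ ∀ k ∈ Kf, ∀ x, f (x * (1, k)) = f x
  smooth : f ∈ G.smoothFunctions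
  finite : FiniteDimensional ℂ (compactSpan Kinf f)
  left_invariant : ∀ (γ : G.points F) (x : G.Adelic), f (G.diagonal γ * x) = f x
  central_char : ∀ (z : G.adelicCenter) (x : G.Adelic), f (z * x) = χ z * f x

variable {Kinf : Subgroup G.ArchGroup} {χ : G.adelicCenter →ₜ* Circle} {f f' : G.Adelic → ℂ}

/-- Forms with different central characters need not add up to an automorphic form, so one χ is
fixed here and carried through all operations. -/
theorem IsAutomorphicForm.exists_with (h : G.IsAutomorphicForm Kinf f) :
    ∃ χ : G.adelicCenter →ₜ* Circle, IsAutomorphicFormWith Kinf χ f :=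
  h.central_char.imp fun _ hχ => ⟨h.finite_smooth, h.arch_smooth, h.finite, h.left_invariant, hχ⟩

namespace IsAutomorphicFormWith

theorem isAutomorphicForm (h : IsAutomorphicFormWith Kinf χ f) : G.IsAutomorphicForm Kinf f :=
  ⟨h.finite_smooth, h.smooth, h.finite, h.left_invariant, χ, h.central_char⟩

theorem add (h : IsAutomorphicFormWith Kinf χ f) (h' : IsAutomorphicFormWith Kinf χ f') :
    IsAutomorphicFormWith Kinf χ (f + f') where
  finite_smooth := by
    obtain ⟨Kf, ho, hc, hK⟩ := h.finite_smooth
    obtain ⟨Kf', ho', -, hK'⟩ := h'.finite_smooth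
    obtain ⟨h1, h2⟩ := exists_open_compact_le ho hc ho'
    exact ⟨Kf ⊓ Kf', h1, h2, fun k hk x => by
      rw [Pi.add_apply, Pi.add_apply, hK k hk.1, hK' k hk.2]⟩
  smooth := add_mem h.smooth h'.smooth
  finite := by
    have := h.finite
    have := h'.finite
    refine Submodule.finiteDimensional_of_le (S₂ := compactSpan Kinf f ⊔ compactSpan Kinf f')
      (Submodule.span_le.2 ?_)
    rintro _ ⟨k, hk, rfl⟩
    exact Submodule.add_mem_sup (Submodule.subset_span ⟨k, hk, rfl⟩)
      (Submodule.subset_span ⟨k, hk, rfl⟩)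
  left_invariant γ x := by
    rw [Pi.add_apply, Pi.add_apply, h.left_invariant, h'.left_invariant]
  central_char z x := by
    rw [Pi.add_apply, Pi.add_apply, h.central_char, h'.central_char, mul_add]

theorem const_smul (h : IsAutomorphicFormWith Kinf χ f) (c : ℂ) :
    IsAutomorphicFormWith Kinf χ (c • f) where
  finite_smooth := by
    obtain ⟨Kf, ho, hc, hK⟩ := h.finite_smooth
    exact ⟨Kf, ho, hc, fun k hk x => by rw [Pi.smul_apply, Pi.smul_apply, hK k hk]⟩
  smooth := Submodule.smul_mem _ c h.smooth
  finite := by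
    have := h.finite
    refine Submodule.finiteDimensional_of_le (S₂ := compactSpan Kinf f) (Submodule.span_le.2 ?_)
    rintro _ ⟨k, hk, rfl⟩
    exact Submodule.smul_mem _ c (Submodule.subset_span ⟨k, hk, rfl⟩)
  left_invariant γ x := by rw [Pi.smul_apply, Pi.smul_apply, h.left_invariant]
  central_char z x := by
    rw [Pi.smul_apply, Pi.smul_apply, h.central_char, smul_eq_mul, smul_eq_mul, mul_left_comm]

theorem translate_fin (h : IsAutomorphicFormWith Kinf χ f) (b : G.FinGroup) :
    IsAutomorphicFormWith Kinf χ (G.rightTranslate (1, b) f) where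
  finite_smooth := by
    obtain ⟨Kf, ho, hc, hK⟩ := h.finite_smooth
    obtain ⟨K', ho', hc', hK'⟩ := exists_open_compact_conj ho hc b
    refine ⟨K', ho', hc', fun k hk x => ?_⟩
    rw [rightTranslate, rightTranslate, ← hK _ (hK' k hk) (x * (1, b))]
    congr 1
    ext1 <;> simp [mul_assoc]
  smooth := rightTranslate_mem_smoothFunctions h.smooth _
  finite := by
    have := h.finite
    refine Submodule.finiteDimensional_of_le
      (S₂ := (compactSpan Kinf f).map (translateLinear (1, b))) (Submodule.span_le.2 ?_)
    rintro _ ⟨k, hk, rfl⟩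
    exact ⟨_, Submodule.subset_span ⟨k, hk, rfl⟩, (rightTranslate_arch_fin k b f).symm⟩
  left_invariant γ x := by rw [rightTranslate, mul_assoc, h.left_invariant]; rfl
  central_char z x := by rw [rightTranslate, mul_assoc, h.central_char]; rfl

theorem translate_compact (h : IsAutomorphicFormWith Kinf χ f) {a : G.ArchGroup} (ha : a ∈ Kinf) :
    IsAutomorphicFormWith Kinf χ (G.rightTranslate (a, 1) f) where
  finite_smooth := by
    obtain ⟨Kf, ho, hc, hK⟩ := h.finite_smooth
    refine ⟨Kf, ho, hc, fun k hk x => ?_⟩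
    rw [rightTranslate, rightTranslate, ← hK k hk (x * (a, 1))]
    congr 1
    ext1 <;> simp [mul_assoc]
  smooth := rightTranslate_mem_smoothFunctions h.smooth _
  finite := by
    have := h.finite
    refine Submodule.finiteDimensional_of_le (S₂ := compactSpan Kinf f) (Submodule.span_le.2 ?_)
    rintro _ ⟨k, hk, rfl⟩
    refine Submodule.subset_span ⟨k * a, Kinf.mul_mem hk ha, ?_⟩
    rw [rightTranslate_rightTranslate, Prod.mk_mul_mk, one_mul]
  left_invariant γ x := by rw [rightTranslate, mul_assoc, h.left_invariant]; rfl
  central_char z x := by rw [rightTranslate, mul_assoc, h.central_char]; rfl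

theorem compactSpan_le (h : f ∈ G.smoothFunctions) : compactSpan Kinf f ≤ G.smoothFunctions := by
  refine Submodule.span_le.2 ?_
  rintro _ ⟨k, -, rfl⟩
  exact rightTranslate_mem_smoothFunctions h _

/-- For K_∞-finiteness, R(k)R(X)f = R(Ad(k)X)R(k)f lies in the span of the first derivatives of the
finite-dimensional space spanned by the K_∞-translates of f. -/
theorem lieDeriv (h : IsAutomorphicFormWith Kinf χ f) (X : G.lieAlgebra) :
    IsAutomorphicFormWith Kinf χ (G.lieDeriv X f) where
  finite_smooth := by
    obtain ⟨Kf, ho, hc, hK⟩ := h.finite_smooth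
    refine ⟨Kf, ho, hc, fun k hk x => ?_⟩
    have h1 : G.rightTranslate (1, k) f = f := funext (hK k hk)
    have h2 := rightTranslate_fin_lieDeriv k X f
    rw [h1] at h2
    exact congrFun h2 x
  smooth := lieDeriv_mem_smoothFunctions h.smooth X
  finite := by
    have := h.finite
    have := finiteDimensional_span_lieDeriv _ (compactSpan_le (Kinf := Kinf) h.smooth)
    refine Submodule.finiteDimensional_of_le (S₂ := Submodule.span ℂ
      {g | ∃ X : G.lieAlgebra, ∃ g' ∈ compactSpan Kinf f, g = G.lieDeriv X g'})
      (Submodule.span_le.2 ?_)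
    rintro _ ⟨k, hk, rfl⟩
    obtain ⟨Y, hY⟩ := exists_rightTranslate_lieDeriv k X
    exact Submodule.subset_span ⟨Y, _, Submodule.subset_span ⟨k, hk, rfl⟩, hY 1 f⟩
  left_invariant γ x := by simp only [LinAlgGroup.lieDeriv, mul_assoc, h.left_invariant]
  central_char z x := by
    simp only [LinAlgGroup.lieDeriv, mul_assoc, h.central_char]
    exact deriv_const_mul_field _

end IsAutomorphicFormWith

/-- Membership in a subspace of derivatives can be checked on a spanning set of smooth functions. -/
theorem lieDeriv_mem_of_mem_span {s : Set (G.Adelic → ℂ)} (hs : s ⊆ G.smoothFunctions)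
    {W : Submodule ℂ (G.Adelic → ℂ)} {X : G.lieAlgebra} (h : ∀ f ∈ s, G.lieDeriv X f ∈ W)
    (hf : f ∈ Submodule.span ℂ s) : G.lieDeriv X f ∈ W := by
  have hle : Submodule.span ℂ s ≤ (W.comap (G.smoothFunctions.subtype ∘ₗ G.lieOperator X)).map
      G.smoothFunctions.subtype :=
    Submodule.span_le.2 fun g hg => ⟨⟨g, hs hg⟩, h g hg, rfl⟩
  obtain ⟨g, hg, rfl⟩ := hle hf
  exact hg

theorem rightTranslate_mem_of_mem_span {s : Set (G.Adelic → ℂ)} {W : Submodule ℂ (G.Adelic → ℂ)}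
    {y : G.Adelic} (h : ∀ f ∈ s, G.rightTranslate y f ∈ W) (hf : f ∈ Submodule.span ℂ s) :
    G.rightTranslate y f ∈ W := by
  have hle : Submodule.span ℂ s ≤ W.comap (translateLinear y) := Submodule.span_le.2 h
  exact hle hf

theorem Reachable.isAutomorphicFormWith (hf : IsAutomorphicFormWith Kinf χ f)
    {g : G.Adelic → ℂ} (hg : G.Reachable Kinf f g) : IsAutomorphicFormWith Kinf χ g := by
  induction hg with
  | base => exact hf
  | finite h f _ ih => exact ih.translate_fin h
  | lie X f _ ih => exact ih.lieDeriv X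
  | compact k hk f _ ih => exact ih.translate_compact hk

theorem isAutomorphicRep_generatedRep (hf : IsAutomorphicFormWith Kinf χ f) :
    G.IsAutomorphicRep Kinf (G.generatedRep Kinf f) where
  isAutomorphicForm g hg := by
    refine IsAutomorphicFormWith.isAutomorphicForm (χ := χ) ?_
    induction hg using Submodule.span_induction with
    | mem g hg => exact Reachable.isAutomorphicFormWith hf hg
    | zero => simpa using hf.const_smul 0
    | add g g' _ _ h h' => exact h.add h'
    | smul c g _ h => exact h.const_smul c
  gk_invariant :=
    { lie_mem := fun X _ hg => lieDeriv_mem_of_mem_span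
        (fun _ h => (Reachable.isAutomorphicFormWith hf h).smooth)
        (fun _ h => Submodule.subset_span (Reachable.lie X _ h)) hg
      compact_mem := fun k hk _ hg => rightTranslate_mem_of_mem_span
        (fun _ h => Submodule.subset_span (Reachable.compact k hk _ h)) hg }
  finite_mem b _ hg := rightTranslate_mem_of_mem_span
    (fun _ h => Submodule.subset_span (Reachable.finite b _ h)) hg

theorem generatedRep_le {W : Submodule ℂ (G.Adelic → ℂ)} (hW : G.IsAutomorphicRep Kinf W)
    (hf : f ∈ W) : G.generatedRep Kinf f ≤ W := by
  refine Submodule.span_le.2 fun g hg => ?_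
  induction hg with
  | base => exact hf
  | finite h f _ ih => exact hW.finite_mem h f ih
  | lie X f _ ih => exact hW.gk_invariant.lie_mem X f ih
  | compact k hk f _ ih => exact hW.gk_invariant.compact_mem k hk f ih

end AutomorphicForms

/-! ### Invariance and countable dimension of the (𝔤, K_∞)-module generated by a function -/

section GKModule

variable {Kinf : Subgroup G.ArchGroup} {f : G.Adelic → ℂ}

theorem foldr_lieDeriv_mem_smoothFunctions (hf : f ∈ G.smoothFunctions) (l : List G.lieAlgebra) :
    l.foldr G.lieDeriv f ∈ G.smoothFunctions := by
  induction l with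
  | nil => exact hf
  | cons X l ih => exact lieDeriv_mem_smoothFunctions ih X

theorem gkModule_le_smoothFunctions (hf : f ∈ G.smoothFunctions) :
    G.gkModule Kinf f ≤ G.smoothFunctions := by
  refine Submodule.span_le.2 ?_
  rintro _ ⟨l, k, -, rfl⟩
  exact foldr_lieDeriv_mem_smoothFunctions (rightTranslate_mem_smoothFunctions hf _) l

theorem exists_rightTranslate_foldr_lieDeriv (a : G.ArchGroup) (l : List G.lieAlgebra)
    (f : G.Adelic → ℂ) : ∃ l' : List G.lieAlgebra,
      G.rightTranslate (a, 1) (l.foldr G.lieDeriv f) =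
        l'.foldr G.lieDeriv (G.rightTranslate (a, 1) f) := by
  induction l with
  | nil => exact ⟨[], rfl⟩
  | cons X l ih =>
    obtain ⟨l', hl'⟩ := ih
    obtain ⟨Y, hY⟩ := exists_rightTranslate_lieDeriv a X
    exact ⟨Y :: l', by rw [List.foldr_cons, hY, hl', List.foldr_cons]⟩

theorem isGKInvariant_gkModule (hf : f ∈ G.smoothFunctions) :
    G.IsGKInvariant Kinf (G.gkModule Kinf f) where
  lie_mem X g hg := by
    refine lieDeriv_mem_of_mem_span ?_ ?_ hg
    · rintro _ ⟨l, k, -, rfl⟩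
      exact foldr_lieDeriv_mem_smoothFunctions (rightTranslate_mem_smoothFunctions hf _) l
    · rintro _ ⟨l, k, hk, rfl⟩
      exact Submodule.subset_span ⟨X :: l, k, hk, rfl⟩
  compact_mem a ha g hg := by
    refine rightTranslate_mem_of_mem_span ?_ hg
    rintro _ ⟨l, k, hk, rfl⟩
    obtain ⟨l', hl'⟩ := exists_rightTranslate_foldr_lieDeriv a l (G.rightTranslate (k, 1) f)
    refine Submodule.subset_span ⟨l', a * k, Kinf.mul_mem ha hk, ?_⟩
    rw [hl', rightTranslate_rightTranslate, Prod.mk_mul_mk, one_mul]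

theorem self_mem_gkModule : f ∈ G.gkModule Kinf f :=
  Submodule.subset_span ⟨[], 1, Kinf.one_mem, (rightTranslate_one f).symm⟩

/-- The span of the derivatives of order `m` of the `K_∞`-translates of `f`. -/
noncomputable def derivativeSpan (Kinf : Subgroup G.ArchGroup) (f : G.Adelic → ℂ) :
    ℕ → Submodule ℂ (G.Adelic → ℂ)
  | 0 => compactSpan Kinf f
  | m + 1 => Submodule.span ℂ
      {g | ∃ X : G.lieAlgebra, ∃ g' ∈ derivativeSpan Kinf f m, g = G.lieDeriv X g'}

theorem derivativeSpan_le (hf : f ∈ G.smoothFunctions) (m : ℕ) :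
    derivativeSpan Kinf f m ≤ G.smoothFunctions := by
  induction m with
  | zero => exact IsAutomorphicFormWith.compactSpan_le hf
  | succ m ih =>
    refine Submodule.span_le.2 ?_
    rintro _ ⟨X, g', hg', rfl⟩
    exact lieDeriv_mem_smoothFunctions (ih hg') X

theorem finiteDimensional_derivativeSpan (hf : f ∈ G.smoothFunctions)
    (hK : FiniteDimensional ℂ (compactSpan Kinf f)) (m : ℕ) :
    FiniteDimensional ℂ (derivativeSpan Kinf f m) := by
  induction m with
  | zero => exact hK
  | succ m ih => exact finiteDimensional_span_lieDeriv _ (derivativeSpan_le hf m)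

theorem gkModule_le_iSup_derivativeSpan :
    G.gkModule Kinf f ≤ ⨆ m, derivativeSpan Kinf f m := by
  refine Submodule.span_le.2 ?_
  rintro _ ⟨l, k, hk, rfl⟩
  have : ∀ l : List G.lieAlgebra,
      l.foldr G.lieDeriv (G.rightTranslate (k, 1) f) ∈ derivativeSpan Kinf f l.length := by
    intro l
    induction l with
    | nil => exact Submodule.subset_span ⟨k, hk, rfl⟩
    | cons X l ih => exact Submodule.subset_span ⟨X, _, ih, rfl⟩
  exact Submodule.mem_iSup_of_mem l.length (this l)

/-- The derivatives of each fixed order span a finite-dimensional space, so countably many vectors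
span everything. This is the hypothesis of Dixmier's lemma. -/
theorem rank_gkModule_le (hf : f ∈ G.smoothFunctions)
    (hK : FiniteDimensional ℂ (compactSpan Kinf f)) :
    Module.rank ℂ (G.gkModule Kinf f) ≤ Cardinal.aleph0 := by
  refine (Submodule.rank_mono gkModule_le_iSup_derivativeSpan).trans ?_
  have hfg : ∀ m, (derivativeSpan Kinf f m).FG := fun m =>
    (Submodule.fg_iff_finiteDimensional _).2 (finiteDimensional_derivativeSpan hf hK m)
  choose t ht using hfg
  rw [← iSup_congr ht, ← Submodule.span_iUnion]
  refine (rank_span_le _).trans ?_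
  rw [Cardinal.le_aleph0_iff_set_countable]
  exact Set.countable_iUnion fun m => (t m).countable_toSet

end GKModule

end LinAlgGroup

namespace LinAlgGroup

variable {F : Type u} [Field F] [NumberField F] {n : ℕ} {G : LinAlgGroup F n}

/-! ### (𝔤, K_∞)-modules as modules over an algebra of operators -/

section OperatorAlgebra

/-- The algebra of operators on smooth functions generated by `𝔤` and `K_∞`. -/
noncomputable def gkAlgebra (G : LinAlgGroup F n) (Kinf : Subgroup G.ArchGroup) :
    Subalgebra ℂ (Module.End ℂ G.smoothFunctions) :=
  Algebra.adjoin ℂ (Set.range G.lieOperator ∪ {T | ∃ k ∈ Kinf, T = G.translateOperator (k, 1)})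

variable {Kinf : Subgroup G.ArchGroup}

noncomputable instance : Ring (G.gkAlgebra Kinf) :=
  Subalgebra.toRing (R := ℂ) (A := Module.End ℂ G.smoothFunctions) (G.gkAlgebra Kinf)

instance : IsScalarTower ℂ (G.gkAlgebra Kinf) G.smoothFunctions :=
  ⟨fun _ _ _ => rfl⟩

theorem lieOperator_mem_gkAlgebra (X : G.lieAlgebra) : G.lieOperator X ∈ G.gkAlgebra Kinf :=
  Algebra.subset_adjoin (Or.inl ⟨X, rfl⟩)

theorem translateOperator_mem_gkAlgebra {k : G.ArchGroup} (hk : k ∈ Kinf) :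
    G.translateOperator (k, 1) ∈ G.gkAlgebra Kinf :=
  Algebra.subset_adjoin (Or.inr ⟨k, hk, rfl⟩)

/-- A `(𝔤, K_∞)`-invariant space of smooth functions as a module over the operator algebra. -/
noncomputable def IsGKInvariant.toSubmodule {W : Submodule ℂ (G.Adelic → ℂ)}
    (hW : G.IsGKInvariant Kinf W) : Submodule (G.gkAlgebra Kinf) G.smoothFunctions where
  carrier := {f | (f : G.Adelic → ℂ) ∈ W}
  zero_mem' := W.zero_mem
  add_mem' h h' := W.add_mem h h'
  smul_mem' a f hf := by
    obtain ⟨a, ha⟩ := a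
    change (a f : G.Adelic → ℂ) ∈ W
    induction ha using Algebra.adjoin_induction generalizing f with
    | mem a ha =>
      rcases ha with ⟨X, rfl⟩ | ⟨k, hk, rfl⟩
      · exact hW.lie_mem X _ hf
      · exact hW.compact_mem k hk _ hf
    | algebraMap c => exact W.smul_mem c hf
    | add a b _ _ iha ihb => exact W.add_mem (iha f hf) (ihb f hf)
    | mul a b _ _ iha ihb => exact iha _ (ihb f hf)

theorem IsGKInvariant.mem_toSubmodule {W : Submodule ℂ (G.Adelic → ℂ)}
    (hW : G.IsGKInvariant Kinf W) {f : G.smoothFunctions} :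
    f ∈ hW.toSubmodule ↔ (f : G.Adelic → ℂ) ∈ W := Iff.rfl

/-- The space of functions underlying a module over the operator algebra. -/
noncomputable def underlyingSpace (N : Submodule (G.gkAlgebra Kinf) G.smoothFunctions) :
    Submodule ℂ (G.Adelic → ℂ) :=
  (N.restrictScalars ℂ).map G.smoothFunctions.subtype

theorem mem_underlyingSpace {N : Submodule (G.gkAlgebra Kinf) G.smoothFunctions}
    {f : G.Adelic → ℂ} :
    f ∈ underlyingSpace N ↔ ∃ g ∈ N, (g : G.Adelic → ℂ) = f := Iff.rfl

theorem isGKInvariant_underlyingSpace (N : Submodule (G.gkAlgebra Kinf) G.smoothFunctions) :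
    G.IsGKInvariant Kinf (underlyingSpace N) where
  lie_mem X f hf := by
    obtain ⟨g, hg, rfl⟩ := mem_underlyingSpace.1 hf
    exact ⟨_, N.smul_mem ⟨_, lieOperator_mem_gkAlgebra X⟩ hg, rfl⟩
  compact_mem k hk f hf := by
    obtain ⟨g, hg, rfl⟩ := mem_underlyingSpace.1 hf
    exact ⟨_, N.smul_mem ⟨_, translateOperator_mem_gkAlgebra hk⟩ hg, rfl⟩

/-- Submodules over the operator algebra and invariant spaces of smooth functions are the same
thing, which makes general module theory available. -/
theorem isSimpleModule_toSubmodule {M : Submodule ℂ (G.Adelic → ℂ)} (hM : G.IsGKInvariant Kinf M)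
    (hMs : M ≤ G.smoothFunctions) (hirr : G.IsIrreducibleGK Kinf M) :
    IsSimpleModule (G.gkAlgebra Kinf) hM.toSubmodule := by
  rw [isSimpleModule_iff_isAtom]
  refine ⟨fun h => ?_, fun N hN => ?_⟩
  · obtain ⟨f, hf, hf0⟩ := M.ne_bot_iff.1 hirr.ne_bot
    have h1 : (⟨f, hMs hf⟩ : G.smoothFunctions) ∈ hM.toSubmodule := hf
    rw [h, Submodule.mem_bot] at h1
    exact hf0 (congrArg Subtype.val h1)
  · have hle : underlyingSpace N ≤ M := by
      intro f hf
      obtain ⟨g, hg, rfl⟩ := mem_underlyingSpace.1 hf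
      exact hN.le hg
    rcases hirr.eq_bot_or_eq _ hle (isGKInvariant_underlyingSpace N) with h | h
    · refine N.eq_bot_iff.2 fun g hg => Subtype.ext ?_
      have : (g : G.Adelic → ℂ) ∈ underlyingSpace N := ⟨g, hg, rfl⟩
      rwa [h, Submodule.mem_bot] at this
    · refine absurd (fun g hg => ?_) hN.not_ge
      have h1 : (g : G.Adelic → ℂ) ∈ underlyingSpace N := by
        rw [h]; exact hg
      obtain ⟨g', hg', he⟩ := mem_underlyingSpace.1 h1
      rwa [← Subtype.ext he]

/-- Right translation by `G(𝔸_f)` commutes with the operator algebra. -/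
noncomputable def finOperator (Kinf : Subgroup G.ArchGroup) (b : G.FinGroup) :
    G.smoothFunctions →ₗ[G.gkAlgebra Kinf] G.smoothFunctions where
  toFun := G.translateOperator (1, b)
  map_add' := map_add _
  map_smul' a f := by
    have hle : G.gkAlgebra Kinf ≤ Subalgebra.centralizer ℂ {G.translateOperator (1, b)} := by
      refine Algebra.adjoin_le ?_
      rintro a (⟨X, rfl⟩ | ⟨k, hk, rfl⟩)
      · rw [SetLike.mem_coe, Subalgebra.mem_centralizer_iff]
        rintro _ rfl
        exact LinearMap.ext fun f => Subtype.ext (rightTranslate_fin_lieDeriv b X f)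
      · rw [SetLike.mem_coe, Subalgebra.mem_centralizer_iff]
        rintro _ rfl
        exact LinearMap.ext fun f => Subtype.ext (rightTranslate_arch_fin k b f).symm
    exact LinearMap.congr_fun ((Subalgebra.mem_centralizer_iff ℂ).1 (hle a.2) _ rfl) f

theorem finOperator_apply (b : G.FinGroup) (f : G.smoothFunctions) :
    (finOperator Kinf b f : G.Adelic → ℂ) = G.rightTranslate (1, b) f := rfl

/-- A submodule that is stable under `G(𝔸_f)` and contains `Φ` contains everything reachable
from `Φ`. -/
theorem generatedRep_le_underlyingSpace {Φ : G.smoothFunctions}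
    {N : Submodule (G.gkAlgebra Kinf) G.smoothFunctions} (hΦ : Φ ∈ N)
    (hN : ∀ b, ∀ f ∈ N, finOperator Kinf b f ∈ N) :
    G.generatedRep Kinf Φ ≤ underlyingSpace N := by
  refine Submodule.span_le.2 fun g hg => ?_
  induction hg with
  | base => exact ⟨Φ, hΦ, rfl⟩
  | finite b f _ ih =>
    obtain ⟨g, hg, rfl⟩ := mem_underlyingSpace.1 ih
    exact ⟨_, hN b g hg, rfl⟩
  | lie X f _ ih => exact (isGKInvariant_underlyingSpace N).lie_mem X f ih
  | compact k hk f _ ih => exact (isGKInvariant_underlyingSpace N).compact_mem k hk f ih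

/-- A nonzero automorphic representation inside the one generated by `Φ` contains a nonzero linear
combination of `G(𝔸_f)`-translates of `Φ`, if `Φ` generates an irreducible `(𝔤, K_∞)`-module. -/
theorem exists_mem_ne_zero_mem_span_translates {Φ : G.Adelic → ℂ} (hΦ : Φ ∈ G.smoothFunctions)
    (hK : FiniteDimensional ℂ (compactSpan Kinf Φ)) (hΦ0 : Φ ≠ 0)
    (hirr : G.IsIrreducibleGK Kinf (G.gkModule Kinf Φ)) {W : Submodule ℂ (G.Adelic → ℂ)}
    (hW : G.IsGKInvariant Kinf W) (hWV : W ≤ G.generatedRep Kinf Φ) (hW0 : W ≠ ⊥) :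
    ∃ w ∈ W, w ≠ 0 ∧ w ∈ Submodule.span ℂ (Set.range fun b => G.rightTranslate (1, b) Φ) := by
  have hM := isGKInvariant_gkModule (Kinf := Kinf) hΦ
  have hsimple := isSimpleModule_toSubmodule hM (gkModule_le_smoothFunctions hΦ) hirr
  let Φs : G.smoothFunctions := ⟨Φ, hΦ⟩
  have hrank : Module.rank ℂ hM.toSubmodule ≤ Cardinal.aleph0 := by
    let j : hM.toSubmodule →ₗ[ℂ] G.gkModule Kinf Φ :=
      { toFun := fun f => ⟨f.1.1, f.2⟩
        map_add' := fun _ _ => rfl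
        map_smul' := fun _ _ => rfl }
    refine (LinearMap.rank_le_of_injective j fun f f' h => ?_).trans (rank_gkModule_le hΦ hK)
    exact Subtype.ext (Subtype.ext
      (congrArg (fun g : G.gkModule Kinf Φ => (g : G.Adelic → ℂ)) h))
  -- The sum of all translates R(b)M. G(𝔸_f) permutes the summands, so N is stable under all three
  -- actions and contains everything generated by Φ.
  let N : Submodule (G.gkAlgebra Kinf) G.smoothFunctions :=
    ⨆ b, hM.toSubmodule.map (finOperator Kinf b)
  have hN : G.generatedRep Kinf Φ ≤ underlyingSpace N := by
    refine generatedRep_le_underlyingSpace (Φ := Φs) ?_ fun b f hf => ?_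
    · refine Submodule.mem_iSup_of_mem 1 ⟨Φs, self_mem_gkModule, Subtype.ext ?_⟩
      exact rightTranslate_one Φ
    · have hle : N ≤ N.comap (finOperator Kinf b) := by
        refine iSup_le fun b' => ?_
        rintro _ ⟨g, hg, rfl⟩
        refine Submodule.mem_iSup_of_mem (b * b') ⟨g, hg, Subtype.ext ?_⟩
        rw [finOperator_apply, finOperator_apply, finOperator_apply, rightTranslate_rightTranslate,
          Prod.mk_mul_mk, one_mul]
      exact hle hf
  have hWN : hW.toSubmodule ≤ N := by
    intro f hf
    obtain ⟨g, hg, he⟩ := mem_underlyingSpace.1 (hN (hWV hf))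
    rwa [← Subtype.ext he]
  have hW0' : hW.toSubmodule ≠ ⊥ := by
    obtain ⟨f, hf, hf0⟩ := W.ne_bot_iff.1 hW0
    obtain ⟨g, hg, he⟩ := mem_underlyingSpace.1 (hN (hWV hf))
    refine (Submodule.ne_bot_iff _).2 ⟨g, ?_, fun h => hf0 ?_⟩
    · rw [IsGKInvariant.mem_toSubmodule, he]; exact hf
    · rw [← he, h, ZeroMemClass.coe_zero]
  obtain ⟨w, hw, hw0, hspan⟩ := exists_mem_ne_zero_mem_span hrank (finOperator Kinf) hWN hW0' (Φ := Φs)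
    (show Φs ∈ hM.toSubmodule from self_mem_gkModule) fun h => hΦ0 (congrArg Subtype.val h)
  refine ⟨w, hw, fun h => hw0 (Subtype.ext h), ?_⟩
  have hle : Submodule.span ℂ (Set.range fun b => finOperator Kinf b Φs) ≤
      (Submodule.span ℂ (Set.range fun b => G.rightTranslate (1, b) Φ)).comap
        G.smoothFunctions.subtype := by
    refine Submodule.span_le.2 ?_
    rintro _ ⟨b, rfl⟩
    exact Submodule.subset_span ⟨b, rfl⟩
  exact hle hspan

end OperatorAlgebra

end LinAlgGroup

namespace LinAlgGroup

variable {F : Type u} [Field F] [NumberField F] {n : ℕ} {G : LinAlgGroup F n}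

/-! ### Recovering Φ from a combination of its translates -/

section Unitarity

variable {Kinf : Subgroup G.ArchGroup} {Φ : G.Adelic → ℂ}

/-- Near x the function depends only on the archimedean variable, since its finite variable can be
moved within the open coset x.2 Kf. -/
theorem continuous_of_smooth (hΦ : Φ ∈ G.smoothFunctions) {Kf : Subgroup G.FinGroup}
    (hKf : IsOpen (Kf : Set G.FinGroup)) (hinv : ∀ k ∈ Kf, ∀ x, Φ (x * (1, k)) = Φ x) :
    Continuous Φ := by
  refine continuous_iff_continuousAt.2 fun x => ?_
  have h1 : Continuous fun y : G.Adelic => Φ (y.1, x.2) :=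
    (isSmooth_slice hΦ x.2).continuous.comp continuous_fst
  refine (h1.continuousAt (x := x)).congr ?_
  have hc : Continuous fun y : G.Adelic => x.2⁻¹ * y.2 := continuous_snd.const_mul _
  have hx : x.2⁻¹ * x.2 ∈ (Kf : Set G.FinGroup) := by
    rw [inv_mul_cancel]; exact Kf.one_mem
  filter_upwards [(hKf.preimage hc).mem_nhds hx] with y hy
  rw [← hinv _ hy (y.1, x.2), Prod.mk_mul_mk, mul_one, mul_inv_cancel_left]

/-- An automorphic form transforms under `G(F)Z(𝔸)` by numbers of absolute value one. -/
theorem exists_rationalCenter_factor (hΦ : G.IsAutomorphicForm Kinf Φ)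
    (γ : G.rationalCenter) : ∃ c : ℂ, ‖c‖ = 1 ∧ ∀ x, Φ (γ * x) = c * Φ x := by
  obtain ⟨χ, hχ⟩ := hΦ.central_char
  obtain ⟨γ, hγ⟩ := γ
  change ∃ c : ℂ, ‖c‖ = 1 ∧ ∀ x, Φ (γ * x) = c * Φ x
  rw [rationalCenter, Subgroup.sup_eq_closure] at hγ
  induction hγ using Subgroup.closure_induction with
  | mem γ hγ =>
    rcases hγ with ⟨δ, rfl⟩ | hz
    · exact ⟨1, norm_one, fun x => by rw [hΦ.left_invariant, one_mul]⟩
    · exact ⟨χ ⟨γ, hz⟩, Circle.norm_coe _, hχ ⟨γ, hz⟩⟩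
  | one => exact ⟨1, norm_one, fun x => by rw [one_mul, one_mul]⟩
  | mul a b _ _ iha ihb =>
    obtain ⟨c, hc, ha⟩ := iha
    obtain ⟨d, hd, hb⟩ := ihb
    exact ⟨c * d, by rw [norm_mul, hc, hd, one_mul], fun x => by rw [mul_assoc, ha, hb, mul_assoc]⟩
  | inv a _ iha =>
    obtain ⟨c, hc, ha⟩ := iha
    have hc0 : c ≠ 0 := fun h => by simp [h] at hc
    refine ⟨c⁻¹, by rw [norm_inv, hc, inv_one], fun x => ?_⟩
    have := ha (a⁻¹ * x)
    rw [mul_inv_cancel_left] at this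
    rw [this, inv_mul_cancel_left₀ hc0]

/-- The factor ψ(γ) is chosen separately for each γ. Only its absolute value matters, so
multiplicativity is not required. -/
theorem exists_isL2Form [MeasurableSpace G.AutQuotient] {μ : Measure G.AutQuotient}
    (hΦ : G.IsAutomorphicForm Kinf Φ) (hsq : G.IsSquareIntegrable μ Φ) :
    ∃ ψ : G.rationalCenter → ℂ, (∀ γ, ‖ψ γ‖ = 1) ∧ IsL2Form G.rationalCenter ψ μ Φ := by
  choose ψ hψ hψΦ using exists_rationalCenter_factor hΦ
  obtain ⟨Kf, hKf, -, hinv⟩ := hΦ.finite_smooth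
  refine ⟨ψ, hψ, continuous_of_smooth hΦ.arch_smooth hKf hinv, hψΦ, ?_⟩
  obtain ⟨a, ha, hfin⟩ := hsq
  refine (lintegral_congr fun q => ?_).trans_lt hfin
  rw [← ha, Quotient.out_eq]

theorem quotientTranslate_mk (y x : G.Adelic) :
    G.quotientTranslate y (Quotient.mk _ x) = Quotient.mk _ (x * y) := rfl

/-- Linear combinations of translates of `Φ` under `G(𝔸_f)` are combinations of finitely many
translates under elements supported on a common finite set of places. -/
theorem exists_sum_of_mem_span_translates {Kf : Subgroup G.FinGroup}
    (hKf : IsOpen (Kf : Set G.FinGroup)) (hinv : ∀ k ∈ Kf, ∀ x, Φ (x * (1, k)) = Φ x)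
    {w : G.Adelic → ℂ}
    (hw : w ∈ Submodule.span ℂ (Set.range fun b => G.rightTranslate (1, b) Φ)) :
    ∃ (S : Finset (FinPlace F)) (m : ℕ) (c : Fin m → ℂ) (h : Fin m → G.FinGroup),
      (∀ i, h i ∈ G.supportedOn (S : Set (FinPlace F))) ∧
      w = ∑ i, c i • G.rightTranslate (1, h i) Φ := by
  classical
  obtain ⟨m, c, g, rfl⟩ := Submodule.mem_span_set'.1 hw
  have key : ∀ i, ∃ (S : Finset (FinPlace F)) (u : G.FinGroup),
      u ∈ G.supportedOn (S : Set (FinPlace F)) ∧ (g i : G.Adelic → ℂ) = G.rightTranslate (1, u) Φ := by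
    intro i
    obtain ⟨b, hb⟩ := (g i).2
    obtain ⟨S, u, hu, huU⟩ := exists_supportedOn_inv_mul_mem b hKf
    refine ⟨S, u, hu, ?_⟩
    rw [← hb]
    -- Since u⁻¹b lies in Kf it fixes Φ, whence R(b)Φ = R(u)Φ.
    have h1 : G.rightTranslate (1, u⁻¹ * b) Φ = Φ := funext (hinv _ huU)
    conv_rhs => rw [← h1, rightTranslate_rightTranslate, Prod.mk_mul_mk, mul_inv_cancel_left,
      one_mul]
  choose S u hu hgu using key
  refine ⟨Finset.univ.biUnion S, m, c, u, fun i => supportedOn_mono ?_ (hu i), ?_⟩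
  · exact Finset.coe_subset.2 (Finset.subset_biUnion_of_mem S (Finset.mem_univ i))
  · simp only [hgu]

/-- A `G(𝔸_f)`-stable space that contains a nonzero linear combination of translates of a
square-integrable Hecke eigenvector `Φ` contains `Φ`. -/
theorem mem_of_mem_span_translates [MeasurableSpace G.AutQuotient] [BorelSpace G.AutQuotient]
    {μ : Measure G.AutQuotient} (hμ : G.IsInvariantMeasure μ)
    [∀ v, MeasurableSpace (G.LocalGroup v)] [∀ v, BorelSpace (G.LocalGroup v)]
    {ν : ∀ v, Measure (G.LocalGroup v)} (hν : ∀ v, (ν v).IsHaarMeasure)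
    {K : ∀ v, Subgroup (G.LocalGroup v)} (hK : ∀ v, IsOpen (K v : Set (G.LocalGroup v)))
    (hKc : ∀ v, IsCompact (K v : Set (G.LocalGroup v)))
    (hΦ : G.IsAutomorphicForm Kinf Φ) (hsq : G.IsSquareIntegrable μ Φ)
    (hinv : ∀ v, ∀ k ∈ K v, G.rightTranslate (1, G.localEmb v k) Φ = Φ)
    (hhecke : ∀ v, G.IsHeckeEigenvector (ν v) (K v) Φ) {W : Submodule ℂ (G.Adelic → ℂ)}
    (hW : ∀ (b : G.FinGroup), ∀ f ∈ W, G.rightTranslate (1, b) f ∈ W) {w : G.Adelic → ℂ}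
    (hwW : w ∈ W) (hw0 : w ≠ 0)
    (hw : w ∈ Submodule.span ℂ (Set.range fun b => G.rightTranslate (1, b) Φ)) : Φ ∈ W := by
  obtain ⟨ψ, hψ, hL⟩ := exists_isL2Form hΦ hsq
  have hT : ∀ y x : G.Adelic, G.quotientTranslate y (Quotient.mk _ x) = Quotient.mk _ (x * y) :=
    quotientTranslate_mk
  have := hμ.regular
  have : μ.IsOpenPosMeasure := isOpenPosMeasure_of_map_eq hT hμ.ne_zero hμ.map_eq
  have hLtr : ∀ {f : G.Adelic → ℂ}, IsL2Form G.rationalCenter ψ μ f → ∀ y,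
      IsL2Form G.rationalCenter ψ μ (G.rightTranslate y f) :=
    fun h y => h.comp_mul_right hT hμ.map_eq hψ y
  have hpair : ∀ {f f' : G.Adelic → ℂ}, IsL2Form G.rationalCenter ψ μ f →
      IsL2Form G.rationalCenter ψ μ f' → ∀ y,
      petersson μ (G.rightTranslate y f) (G.rightTranslate y f') = petersson μ f f' :=
    fun h h' y => petersson_comp_mul_right hT hμ.map_eq hψ h h' y
  have hle : Submodule.span ℂ (Set.range fun b => G.rightTranslate (1, b) Φ) ≤ l2Forms μ hψ := by
    refine Submodule.span_le.2 ?_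
    rintro _ ⟨b, rfl⟩
    exact hLtr hL _
  have hwL : IsL2Form G.rationalCenter ψ μ w := hle hw
  -- Otherwise w, being a combination of translates of Φ, would be orthogonal to itself.
  obtain ⟨b, hb⟩ : ∃ b, petersson μ (G.rightTranslate (1, b) Φ) w ≠ 0 := by
    by_contra! h
    refine petersson_self_ne_zero hψ hwL hw0 ?_
    suffices H : ∀ f ∈ Submodule.span ℂ (Set.range fun b => G.rightTranslate (1, b) Φ),
        petersson μ f w = 0 from H w hw
    intro f hf
    induction hf using Submodule.span_induction with
    | mem f hf =>
      obtain ⟨b, rfl⟩ := hf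
      exact h b
    | zero => simp [petersson, quotientPairing]
    | add f f' hf hf' h h' => rw [petersson_add hψ (hle hf) (hle hf') hwL, h, h', add_zero]
    | smul c f _ h => rw [petersson_const_smul, h, mul_zero]
  -- By unitarity, translating w by b⁻¹ replaces the pairing with R(b)Φ by the pairing with Φ.
  let w' := G.rightTranslate (1, b⁻¹) w
  have hw'W : w' ∈ W := hW _ _ hwW
  have hw'L : IsL2Form G.rationalCenter ψ μ w' := hLtr hwL _
  have hw'Φ : petersson μ w' Φ ≠ 0 := by
    intro h
    rw [← hpair hw'L hL (1, b), rightTranslate_rightTranslate, Prod.mk_mul_mk, mul_inv_cancel,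
      one_mul] at h
    have h1 : G.rightTranslate (1, 1) w = w := rightTranslate_one w
    rw [h1, ← petersson_conj, map_eq_zero] at h
    exact hb h
  have hw' : w' ∈ Submodule.span ℂ (Set.range fun b => G.rightTranslate (1, b) Φ) := by
    refine rightTranslate_mem_of_mem_span ?_ hw
    rintro _ ⟨b', rfl⟩
    refine Submodule.subset_span ⟨b⁻¹ * b', ?_⟩
    rw [rightTranslate_rightTranslate, Prod.mk_mul_mk, one_mul]
  obtain ⟨Kf, hKf, -, hKfinv⟩ := hΦ.finite_smooth
  obtain ⟨S, m, c, h, hS, hsum⟩ := exists_sum_of_mem_span_translates hKf hKfinv hw'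
  obtain ⟨J, _, _, k, -, hkΦ, hkh⟩ := exists_average ν hν hK hKc hinv hhecke S h hS
  choose d hd using hkh
  have hav : ∑ j, G.rightTranslate (1, k j) w' = (∑ i, c i * d i) • Φ := by
    have e : ∀ j, G.rightTranslate (1, k j) w' =
        ∑ i, c i • G.rightTranslate (1, k j * h i) Φ := by
      intro j
      change translateLinear (1, k j) w' = _
      rw [hsum, map_sum]
      refine Finset.sum_congr rfl fun i _ => ?_
      rw [map_smul]
      congr 1
      refine (rightTranslate_rightTranslate _ _ _).trans ?_
      rw [Prod.mk_mul_mk, one_mul]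
    simp only [e]
    rw [Finset.sum_comm, Finset.sum_smul]
    refine Finset.sum_congr rfl fun i _ => ?_
    rw [← Finset.smul_sum, hd, smul_smul]
  -- Each k_j fixes Φ, so every R(k_j)w' pairs with Φ as w' does. The pairing of the sum with Φ is
  -- |J|⟨w', Φ⟩ ≠ 0, as J is nonempty.
  have hne : ∑ i, c i * d i ≠ 0 := by
    intro h0
    rw [h0, zero_smul] at hav
    have h1 := petersson_sum hψ Finset.univ (fun j => hLtr hw'L (1, k j)) hL
    have h2 : ∀ j, petersson μ (G.rightTranslate (1, k j) w') Φ = petersson μ w' Φ := by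
      intro j
      conv_lhs => rw [← hkΦ j]
      exact hpair hw'L hL _
    rw [hav] at h1
    simp only [h2, Finset.sum_const, Finset.card_univ, nsmul_eq_mul] at h1
    have h3 : petersson μ (0 : G.Adelic → ℂ) Φ = 0 := by simp [petersson, quotientPairing]
    rw [h3] at h1
    exact mul_ne_zero (Nat.cast_ne_zero.2 Fintype.card_ne_zero) hw'Φ h1.symm
  have hmem : (∑ i, c i * d i) • Φ ∈ W := by
    rw [← hav]
    exact W.sum_mem fun j _ => hW _ _ hw'W
  exact (W.smul_mem_iff hne).1 hmem

end Unitarity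

end LinAlgGroup

/-! ### Irreducibility of the generated representation -/

theorem theorem1 {F : Type u} [Field F] [NumberField F] {n : ℕ} (G : LinAlgGroup F n)
    (Kinf : Subgroup G.ArchGroup) (hKinf : IsMaximalCompact Kinf)
    [MeasurableSpace G.AutQuotient] [BorelSpace G.AutQuotient]
    (μ : MeasureTheory.Measure G.AutQuotient) (hμ : G.IsInvariantMeasure μ)
    [∀ v, MeasurableSpace (G.LocalGroup v)] [∀ v, BorelSpace (G.LocalGroup v)]
    (ν : ∀ v, MeasureTheory.Measure (G.LocalGroup v)) (hν : ∀ v, (ν v).IsHaarMeasure)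
    (K : ∀ v, Subgroup (G.LocalGroup v))
    (hK_open : ∀ v, IsOpen (K v : Set (G.LocalGroup v)))
    (hK_compact : ∀ v, IsCompact (K v : Set (G.LocalGroup v)))
    (hK_max : ∀ᶠ v in Filter.cofinite, IsMaximalCompact (K v))
    (Φ : G.Adelic → ℂ) (hΦ : G.IsAutomorphicForm Kinf Φ)
    (hΦ_sq : G.IsSquareIntegrable μ Φ)
    (hΦ_gk : G.IsIrreducibleGK Kinf (G.gkModule Kinf Φ))
    (hΦ_inv : ∀ v, ∀ k ∈ K v, G.rightTranslate (1, G.localEmb v k) Φ = Φ)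
    (hΦ_hecke : ∀ v, G.IsHeckeEigenvector (ν v) (K v) Φ) :
    G.IsIrreducibleRep Kinf (G.generatedRep Kinf Φ) := by
  obtain ⟨χ, hχ⟩ := hΦ.exists_with
  have hbase : Φ ∈ G.generatedRep Kinf Φ := Submodule.subset_span LinAlgGroup.Reachable.base
  have hΦ0 : Φ ≠ 0 := by
    rintro rfl
    refine hΦ_gk.ne_bot (le_bot_iff.1 (Submodule.span_le.2 ?_))
    rintro _ ⟨l, k, -, rfl⟩
    induction l with
    | nil => rfl
    | cons X l ih =>
      rw [List.foldr_cons, (Submodule.mem_bot ℂ).1 ih]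
      exact funext fun x => deriv_const 0 _
  refine ⟨LinAlgGroup.isAutomorphicRep_generatedRep hχ, (Submodule.ne_bot_iff _).2 ⟨Φ, hbase, hΦ0⟩,
    fun W hWV hW => or_iff_not_imp_left.2 fun hW0 => le_antisymm hWV ?_⟩
  -- Any nonzero subrepresentation W contains such a w, hence contains Φ and all that Φ generates.
  obtain ⟨w, hwW, hw0, hw⟩ := LinAlgGroup.exists_mem_ne_zero_mem_span_translates hχ.smooth hχ.finite
    hΦ0 hΦ_gk hW.gk_invariant hWV hW0
  exact LinAlgGroup.generatedRep_le hW (LinAlgGroup.mem_of_mem_span_translates hμ hν hK_open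
    hK_compact hΦ hΦ_sq hΦ_inv hΦ_hecke hW.finite_mem hwW hw0 hw)
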